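/- **Setting.** A game $G$ is a finite two-player zero-sum game tree with perfect information, simultaneous moves and no chance nodes: at each inner node $h$ the players choose actions $i$ and $j$ from finite non-empty sets, which leads to the child $h_{ij}$; each terminal node has a utility in $[0,1]$ (for player 1). Its depth $D$ is the largest number of inner nodes on a path from the root. A bandit algorithm $A$ chooses, for any finite number of actions, its next action at random with a distribution that depends on its own past actions and the rewards received for them. *SM-MCTS with selection algorithm $A$*, on the fully built tree, repeats the following iteration: starting from the root, at each inner node reached both players independently select an action by their own copy of $A$ kept at that node, until a terminal node with utility $x$ is reached; then at each inner node on the path the copy of player 1 receives the reward $x$ and that of player 2 the reward $1-x$. **Hypotheses.** Let $\varepsilon\ge 0$. * *$\varepsilon$-Hannan consistency:* for every number of actions and every adversary who in each step $s$ assigns rewards $x_i(s)\in[0,1]$ to all actions, knowing the past actions of $A$, the actions $i(1),i(2),\dots$ of $A$ almost surely satisfy $\limsup_{t\to\infty}\frac1t\big(\max_i\sum_{s\le t}x_i(s)-\sum_{s\le t}x_{i(s)}(s)\big)\le\varepsilon$. * *Guaranteed exploration:* when both players use $A$, then in every game and at every inner node $h$, almost surely every joint action $(i,j)$ has $t_{ij}\to\infty$,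 where $t_{ij}$ is the number of its uses during the first $t$ visits of $h$. * *$\varepsilon$-unbiased payoff observations ($\varepsilon$-UPO):* for every game, every inner node $h$ and all actions $i,j$ at $h$, in SM-MCTS with $A$ almost surely $\limsup_{n\to\infty}|\tilde s_{ij}(n)-\bar s_{ij}(n)|\le\varepsilon$. Here $s_{ij}(m)$ is the payoff obtained when $h_{ij}$ is sampled from $h$ for the $m$-th time; $w_{ij}(m)$ is $1$ plus the number of visits of $h$ between the $(m-1)$-st use (for $m=1$: the start) and the $m$-th use of $(i,j)$ at which player 2 plays $j$ but player 1 does not play $i$; and $$\bar s_{ij}(n)=\frac1n\sum_{m=1}^n s_{ij}(m),\qquad \tilde s_{ij}(n)=\frac{\sum_{m=1}^n w_{ij}(m)s_{ij}(m)}{\sum_{m=1}^n w_{ij}(m)}.$$ **Theorem.** Let $A$ be an $\varepsilon$-Hannan consistent algorithm with guaranteed exploration and $\varepsilon$-UPO, and let $G$ be a game of depth $D$. Run SM-MCTS with $A$ as selection algorithm of both players on $G$. Let $\bar\sigma(T)$ be the profile of average strategies after $T$ iterations (at each node, the average over its visits so far of the distributions from which the actions were drawn) and $\hat\sigma(T)$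 the profile of empirical action frequencies. Then almost surely, for every $\eta>0$ there is $T_0$ such that for all $T\ge T_0$ both $\bar\sigma(T)$ and $\hat\sigma(T)$ are $(C\varepsilon+\eta)$-Nash equilibria of the whole game $G$, where $C=12(2^D-1)-8D$. -/

import Mathlib

open MeasureTheory Filter
open scoped unitInterval

noncomputable section

/-- A finite two-player zero-sum simultaneous-move game with perfect information and without
chance nodes, as a game tree. A terminal state carries the utility `u₁ ∈ [0,1]` of player 1. In an
inner state player 1 has the `m + 1` actions `Fin (m + 1)`, player 2 has the `n + 1` actions
`Fin (n + 1)`, and the joint action `(i, j)` leads to the state `child i j`. -/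
inductive Game : Type
  | terminal (u : I) : Game
  | node (m n : ℕ) (child : Fin (m + 1) → Fin (n + 1) → Game) : Game

namespace Game

/-- Depth of the game tree, terminal states not counted (a matrix game has depth `1`). -/
def depth : Game → ℕ
  | terminal _ => 0
  | node _ _ c => 1 + Finset.univ.sup fun i => Finset.univ.sup fun j => depth (c i j)

end Game

/-- A family that assigns to every inner node of a game, with `m + 1` and `n + 1` actions, an
element of `F m n`. -/
def NodeMap (F : ℕ → ℕ → Type) : Game → Type
  | .terminal _ => Unit
  | .node m n c => F m n × (∀ i j, NodeMap F (c i j))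

namespace NodeMap

/-- The same element `a m n` at every inner node with `m + 1` and `n + 1` actions. -/
def const {F : ℕ → ℕ → Type} (a : ∀ m n, F m n) : (G : Game) → NodeMap F G
  | .terminal _ => ()
  | .node m n c => (a m n, fun i j => const a (c i j))

/-- Apply `f` at every inner node. -/
def map {F F' : ℕ → ℕ → Type} (f : ∀ m n, F m n → F' m n) :
    (G : Game) → NodeMap F G → NodeMap F' G
  | .terminal _, _ => ()
  | .node m n c, x => (f m n x.1, fun i j => map f (c i j) (x.2 i j))

/-- The property `P` holds at every inner node. -/
def All {F : ℕ → ℕ → Type} (P : ∀ m n, F m n → Prop) : (G : Game) → NodeMap F G → Prop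
  | .terminal _, _ => True
  | .node m n c, x => P m n x.1 ∧ ∀ i j, All P (c i j) (x.2 i j)

end NodeMap

/-! ### Behavioral strategies, expected utility, approximate Nash equilibria -/

/-- A weight for each action of player 1 at each inner node (see `IsStrategy₁`). -/
abbrev Weights₁ (G : Game) : Type := NodeMap (fun m _ => Fin (m + 1) → ℝ) G

/-- A weight for each action of player 2 at each inner node (see `IsStrategy₂`). -/
abbrev Weights₂ (G : Game) : Type := NodeMap (fun _ n => Fin (n + 1) → ℝ) G

/-- `s` is a behavioral strategy of player 1: a probability distribution at every inner node. -/
def IsStrategy₁ (G : Game) (s : Weights₁ G) : Prop :=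
  NodeMap.All (fun m _ p => p ∈ stdSimplex ℝ (Fin (m + 1))) G s

/-- `s` is a behavioral strategy of player 2: a probability distribution at every inner node. -/
def IsStrategy₂ (G : Game) (s : Weights₂ G) : Prop :=
  NodeMap.All (fun _ n p => p ∈ stdSimplex ℝ (Fin (n + 1))) G s

/-- Expected utility of player 1: the sum over the terminal states of the probability of reaching
the state times its utility, summed up along the tree. -/
def utility : (G : Game) → Weights₁ G → Weights₂ G → ℝ
  | .terminal u, _, _ => (u : ℝ)
  | .node _ _ c, s₁, s₂ =>
      ∑ i, ∑ j, s₁.1 i * s₂.1 j * utility (c i j) (s₁.2 i j) (s₂.2 i j)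

/-- `(s₁, s₂)` is an `e`-Nash equilibrium of `G`: a pair of behavioral strategies from which no
player can gain more than `e` by deviating unilaterally. -/
def IsApproxNash (G : Game) (e : ℝ) (s₁ : Weights₁ G) (s₂ : Weights₂ G) : Prop :=
  IsStrategy₁ G s₁ ∧ IsStrategy₂ G s₂ ∧
    (∀ s₁', IsStrategy₁ G s₁' → utility G s₁' s₂ - utility G s₁ s₂ ≤ e) ∧
    (∀ s₂', IsStrategy₂ G s₂' → utility G s₁ s₂ - utility G s₁ s₂' ≤ e)

/-! ### Bandit algorithms and Hannan consistency -/

/-- A randomized algorithm for multi-armed bandits. When there are `k + 1` actions and `H` is the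
list of its past actions with the rewards received for them (oldest first), it draws a fresh
uniformly distributed number `u ∈ [0,1]` and plays `select k H u`. -/
structure BanditAlgorithm where
  select : (k : ℕ) → List (Fin (k + 1) × I) → I → Fin (k + 1)
  measurable_select : ∀ k H, Measurable (select k H)

namespace BanditAlgorithm

/-- The probability with which `A` plays the action `i` after the history `H`. -/
def prob (A : BanditAlgorithm) (k : ℕ) (H : List (Fin (k + 1) × I)) (i : Fin (k + 1)) : ℝ :=
  (volume : Measure I).real {u | A.select k H u = i}

/-- History of `A` after `t` steps against an adaptive adversary, who assigns the rewards of all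
actions in each step, knowing the past actions of `A`. The number drawn in step `s` is `U s`. -/
def banditHist (A : BanditAlgorithm) {k : ℕ} (x : List (Fin (k + 1)) → Fin (k + 1) → I)
    (U : ℕ → I) : ℕ → List (Fin (k + 1) × I)
  | 0 => []
  | t + 1 =>
      let H := banditHist A x U t
      let i := A.select k H (U t)
      H ++ [(i, x (H.map Prod.fst) i)]

/-- The action played in step `t` (steps are numbered from `0`). -/
def banditAction (A : BanditAlgorithm) {k : ℕ} (x : List (Fin (k + 1)) → Fin (k + 1) → I)
    (U : ℕ → I) (t : ℕ) : Fin (k + 1) :=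
  A.select k (A.banditHist x U t) (U t)

/-- The reward assigned to the action `i` in step `t`. -/
def banditReward (A : BanditAlgorithm) {k : ℕ} (x : List (Fin (k + 1)) → Fin (k + 1) → I)
    (U : ℕ → I) (t : ℕ) (i : Fin (k + 1)) : ℝ :=
  x ((A.banditHist x U t).map Prod.fst) i

/-- The external regret after `t` steps. -/
def regret (A : BanditAlgorithm) {k : ℕ} (x : List (Fin (k + 1)) → Fin (k + 1) → I)
    (U : ℕ → I) (t : ℕ) : ℝ :=
  (⨆ i, ∑ s ∈ Finset.range t, A.banditReward x U s i) -
    ∑ s ∈ Finset.range t, A.banditReward x U s (A.banditAction x U s)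

/-- `ε`-Hannan consistency: for every number of actions and every adversary, the upper limit of the
average regret is almost surely at most `ε`. -/
def IsHannanConsistent (A : BanditAlgorithm) (ε : ℝ) : Prop :=
  ∀ (k : ℕ) (x : List (Fin (k + 1)) → Fin (k + 1) → I),
    ∀ᵐ U ∂(Measure.infinitePi fun _ : ℕ => (volume : Measure I)),
      limsup (fun t : ℕ => A.regret x U t / t) atTop ≤ ε

end BanditAlgorithm

/-! ### SM-MCTS -/

/-- The random numbers used by SM-MCTS: `ω (p, b, t)` is used at the `t`-th visit (from `0`) of the
node with address `p` (the list of joint actions leading to it from the root) to select the action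
of player 1 if `b = false`, and of player 2 if `b = true`. -/
abbrev Tape : Type := List (ℕ × ℕ) × Bool × ℕ → I

/-- All random numbers are independent and uniformly distributed on `[0,1]`. -/
def tapeMeasure : Measure Tape := Measure.infinitePi fun _ => (volume : Measure I)

/-- The random numbers used in the subgame rooted at the child `(i, j)`. -/
def Tape.child (ω : Tape) (i j : ℕ) : Tape := fun q => ω ((i, j) :: q.1, q.2)

/-- What is stored at a node: for each visit (oldest first) the joint action selected there and the
payoff `x` (to player 1) returned by that iteration. -/
abbrev Hist (m n : ℕ) : Type := List (Fin (m + 1) × Fin (n + 1) × I)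

namespace Hist

/-- What the algorithm of player 1 sees: own actions, and the rewards `x`. -/
def view₁ {m n : ℕ} (H : Hist m n) : List (Fin (m + 1) × I) := H.map fun e => (e.1, e.2.2)

/-- What the algorithm of player 2 sees: own actions, and the rewards `1 - x`. -/
def view₂ {m n : ℕ} (H : Hist m n) : List (Fin (n + 1) × I) :=
  H.map fun e => (e.2.1, unitInterval.symm e.2.2)

/-- Empirical frequencies of the actions of player 1. -/
def empirical₁ {m n : ℕ} (H : Hist m n) (i : Fin (m + 1)) : ℝ :=
  ((H.map fun e => e.1).count i : ℝ) / H.length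

/-- Empirical frequencies of the actions of player 2. -/
def empirical₂ {m n : ℕ} (H : Hist m n) (j : Fin (n + 1)) : ℝ :=
  ((H.map fun e => e.2.1).count j : ℝ) / H.length

/-- Average over the past visits of the mixed strategies with which player 1 selected actions. -/
def average₁ (A : BanditAlgorithm) {m n : ℕ} (H : Hist m n) (i : Fin (m + 1)) : ℝ :=
  (∑ s ∈ Finset.range H.length, A.prob m (view₁ (H.take s)) i) / H.length

/-- Average over the past visits of the mixed strategies with which player 2 selected actions. -/
def average₂ (A : BanditAlgorithm) {m n : ℕ} (H : Hist m n) (j : Fin (n + 1)) : ℝ :=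
  (∑ s ∈ Finset.range H.length, A.prob n (view₂ (H.take s)) j) / H.length

end Hist

/-- The contents of all nodes of the (fully built) tree. -/
abbrev State (G : Game) : Type := NodeMap Hist G

namespace BanditAlgorithm

/-- The joint action selected at the root of a game whose node contains `H`. -/
def selectAt (A : BanditAlgorithm) {m n : ℕ} (ω : Tape) (H : Hist m n) :
    Fin (m + 1) × Fin (n + 1) :=
  (A.select m H.view₁ (ω ([], false, H.length)), A.select n H.view₂ (ω ([], true, H.length)))

/-- One iteration of SM-MCTS with the selection algorithm `A`: the new contents of the tree, and
the returned payoff. -/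
def iteration (A : BanditAlgorithm) : (G : Game) → Tape → State G → State G × I
  | .terminal u, _, _ => ((), u)
  | .node _ _ c, ω, S =>
      let a := A.selectAt ω S.1
      let r := iteration A (c a.1 a.2) (ω.child a.1 a.2) (S.2 a.1 a.2)
      ((S.1 ++ [(a.1, a.2, r.2)],
        Function.update S.2 a.1 (Function.update (S.2 a.1) a.2 r.1)), r.2)

/-- The contents of the tree after `T` iterations of SM-MCTS. -/
def run (A : BanditAlgorithm) (G : Game) (ω : Tape) : ℕ → State G
  | 0 => NodeMap.const (fun _ _ => []) G
  | T + 1 => (A.iteration G ω (run A G ω T)).1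

/-- The payoff returned by iteration number `t` (from `0`) of SM-MCTS. -/
def payoff (A : BanditAlgorithm) (G : Game) (ω : Tape) (t : ℕ) : I :=
  (A.iteration G ω (A.run G ω t)).2

/-- Empirical frequencies `σ̂₁(T)` of player 1 at all nodes after `T` iterations. -/
def empiricalStrategy₁ (A : BanditAlgorithm) (G : Game) (ω : Tape) (T : ℕ) : Weights₁ G :=
  NodeMap.map (fun _ _ H => Hist.empirical₁ H) G (A.run G ω T)

/-- Empirical frequencies `σ̂₂(T)` of player 2 at all nodes after `T` iterations. -/
def empiricalStrategy₂ (A : BanditAlgorithm) (G : Game) (ω : Tape) (T : ℕ) : Weights₂ G :=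
  NodeMap.map (fun _ _ H => Hist.empirical₂ H) G (A.run G ω T)

/-- Average strategy `σ̄₁(T)` of player 1 at all nodes after `T` iterations. -/
def averageStrategy₁ (A : BanditAlgorithm) (G : Game) (ω : Tape) (T : ℕ) : Weights₁ G :=
  NodeMap.map (fun _ _ H => Hist.average₁ A H) G (A.run G ω T)

/-- Average strategy `σ̄₂(T)` of player 2 at all nodes after `T` iterations. -/
def averageStrategy₂ (A : BanditAlgorithm) (G : Game) (ω : Tape) (T : ℕ) : Weights₂ G :=
  NodeMap.map (fun _ _ H => Hist.average₂ A H) G (A.run G ω T)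

/-! ### Behavior at a node

A node `h` of a larger game, in its own time (the number of its visits), behaves exactly like the
root of SM-MCTS run on the subgame rooted at `h`, because what happens above `h` only affects when
`h` is visited. As the subgame is itself a game, "every game and every node" below is "every game
`.node m n c` at its root". -/

section Root

variable (A : BanditAlgorithm) {m n : ℕ} (c : Fin (m + 1) → Fin (n + 1) → Game) (ω : Tape)

/-- The joint action `(i(t), j(t))` selected at the `t`-th visit (from `0`). -/
def rootAction (t : ℕ) : Fin (m + 1) × Fin (n + 1) :=
  A.selectAt ω (A.run (.node m n c) ω t).1

/-- The number `t_{ij}` of uses of the joint action `(i, j)` during the first `t` visits. -/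
def uses (i : Fin (m + 1)) (j : Fin (n + 1)) (t : ℕ) : ℕ :=
  ((Finset.range t).filter fun s => A.rootAction c ω s = (i, j)).card

/-- `s_{ij}`: the payoff obtained when the child `(i, j)` is sampled for the `k`-th time
(from `0`). -/
def sample (i : Fin (m + 1)) (j : Fin (n + 1)) (k : ℕ) : ℝ :=
  A.payoff (c i j) (ω.child i j) k

/-- `t*_{ij}(k)`: the least number of visits after which `(i, j)` has been used `k` times. -/
def useTime (i : Fin (m + 1)) (j : Fin (n + 1)) (k : ℕ) : ℕ :=
  sInf {t | A.uses c ω i j t = k}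

/-- `w_{ij}`: one plus the number of visits, between the `k`-th and the `(k+1)`-st use of `(i, j)`,
at which player 2 played `j` but player 1 did not play `i`. (Uses are counted from `1` in this
sentence; `weight k` is the weight of `sample k`.) -/
def weight (i : Fin (m + 1)) (j : Fin (n + 1)) (k : ℕ) : ℕ :=
  1 + Set.ncard {t | A.useTime c ω i j k ≤ t ∧ t < A.useTime c ω i j (k + 1) ∧
    (A.rootAction c ω t).2 = j ∧ (A.rootAction c ω t).1 ≠ i}

/-- `s̄_{ij}(N)`: the arithmetic average of the first `N` samples. -/
def plainAverage (i : Fin (m + 1)) (j : Fin (n + 1)) (N : ℕ) : ℝ :=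
  (∑ k ∈ Finset.range N, A.sample c ω i j k) / N

/-- `s̃_{ij}(N)`: the weighted average of the first `N` samples. -/
def weightedAverage (i : Fin (m + 1)) (j : Fin (n + 1)) (N : ℕ) : ℝ :=
  (∑ k ∈ Finset.range N, (A.weight c ω i j k : ℝ) * A.sample c ω i j k) /
    ∑ k ∈ Finset.range N, (A.weight c ω i j k : ℝ)

end Root

/-- Guaranteed exploration: if both players select actions by `A`, then almost surely each joint
action is used infinitely often. -/
def GuaranteedExploration (A : BanditAlgorithm) : Prop :=
  ∀ (m n : ℕ) (c : Fin (m + 1) → Fin (n + 1) → Game) (i : Fin (m + 1)) (j : Fin (n + 1)),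
    ∀ᵐ ω ∂tapeMeasure, Tendsto (fun t => A.uses c ω i j t) atTop atTop

/-- `ε`-unbiased payoff observations (`ε`-UPO). -/
def UnbiasedPayoffObservations (A : BanditAlgorithm) (ε : ℝ) : Prop :=
  ∀ (m n : ℕ) (c : Fin (m + 1) → Fin (n + 1) → Game) (i : Fin (m + 1)) (j : Fin (n + 1)),
    ∀ᵐ ω ∂tapeMeasure,
      limsup (fun N : ℕ => |A.weightedAverage c ω i j N - A.plainAverage c ω i j N|) atTop ≤ ε

end BanditAlgorithm

end

/-!
The proof compares SM-MCTS with a value `v` of the game (`IsValue`) and shows that asymptotically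
each player guarantees `v` up to `2 * D ^ 2 * ε` by the empirical frequencies or the average
strategies. Such a pair of strategies is an equilibrium up to `4 * D ^ 2 * ε`, and
`4 * D ^ 2 ≤ 12 * (2 ^ D - 1) - 8 * D`.

*Reduction to the bandit problem.* Fix all random numbers except those of player 1 at the root. The
rewards of player 1 are then a function of the past actions of player 1: the reward of an action `i`
is the next sample of the child to which `i` and the action of player 2 lead (`hypothetical`). So
player 1 faces an adaptive adversary (`banditHist_adversary`), and by Fubini's theorem Hannan
consistency bounds the regret with respect to these hypothetical rewards
(`IsHannanConsistent.ae_eventually_le`). Fubini's theorem needs measurability, while the algorithm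
is measurable only for each fixed history; this is enough because the contents of the tree after `T`
iterations take only finitely many values (`isSimple_run`).

*Observed values.* Summing the hypothetical rewards of `i` over the visits at which player 2 selects
`j` weights each sample of the child `(i, j)` by exactly the weight in the definition of unbiased
payoff observations, up to the last, incomplete group of visits. Hence, if the average payoff at a
child of depth `d` is eventually at least its value minus `(2 * d - 1) * ε`, then what player 1
observes there is at least the value minus `2 * d * ε`; for a terminal child there is no error at
all (`eventually_le_weightedAverage`, `eventually_sum_le_hypothetical`). Adding the regret `ε` gives
`eventually_empirical_le`: at a node of depth `d`, no action of player 1 beats the average payoff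
against the empirical frequencies of player 2 by more than `(2 * d - 1) * ε` in the matrix of the
values of the children. As some action gets at least the value of this matrix, the average payoff is
at least `v - (2 * d - 1) * ε` (`eventually_le_payoffAverage`), which closes the induction.

*Best responses.* By symmetry the average payoff is at most `v + (2 * d - 1) * ε`. So every node of
depth `d` adds at most `2 * (2 * d - 1) * ε` to what a best response of player 1 gains over the
value, and the sum over `d = 1, …, D` is `2 * D ^ 2 * ε` (`eventually_utility_le`). The average
strategies can replace the empirical frequencies because their difference is an average of bounded
martingale differences (`ae_tendsto_average_zero`).

*Symmetry.* The hypotheses are applied to player 1 only. The statements for player 2 follow by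
running SM-MCTS on the game with the players exchanged (`run_swap`).
-/

noncomputable section

/-! ### Simple functions without a measurable structure on the target -/

/-- `f` takes finitely many values, each of them on a measurable set. In contrast to measurability
this makes sense when the target carries no `σ`-algebra. -/
def IsSimple {Ω α : Type*} [MeasurableSpace Ω] (f : Ω → α) : Prop :=
  ∃ s : SimpleFunc Ω α, ⇑s = f

namespace IsSimple

variable {Ω Ω' α β : Type*} [MeasurableSpace Ω] [MeasurableSpace Ω']

lemma const (a : α) : IsSimple fun _ : Ω => a := ⟨SimpleFunc.const Ω a, rfl⟩

lemma bind {f : Ω → α} {g : α → Ω → β} (hf : IsSimple f) (hg : ∀ a, IsSimple (g a)) :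
    IsSimple fun ω => g (f ω) ω := by
  obtain ⟨s, rfl⟩ := hf
  choose r hr using hg
  exact ⟨s.bind r, funext fun ω => by simp [hr]⟩

lemma map {f : Ω → α} (hf : IsSimple f) (g : α → β) : IsSimple fun ω => g (f ω) :=
  hf.bind fun a => const (g a)

lemma comp {f : Ω → α} (hf : IsSimple f) {φ : Ω' → Ω} (hφ : Measurable φ) :
    IsSimple fun ω => f (φ ω) := by
  obtain ⟨s, rfl⟩ := hf
  exact ⟨s.comp φ hφ, rfl⟩

lemma of_measurable [Finite α] [MeasurableSpace α] [MeasurableSingletonClass α] {f : Ω → α}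
    (hf : Measurable f) : IsSimple f :=
  ⟨⟨f, fun x => hf (measurableSet_singleton x), Set.toFinite _⟩, rfl⟩

lemma measurable [MeasurableSpace α] {f : Ω → α} (hf : IsSimple f) : Measurable f := by
  obtain ⟨s, rfl⟩ := hf
  exact s.measurable

end IsSimple

/-! ### Resampling coordinates of a product measure -/

lemma measurable_extend {ι κ X : Type*} [MeasurableSpace X] {e : κ → ι}
    (he : Function.Injective e) :
    Measurable fun p : (ι → X) × (κ → X) => Function.extend e p.2 p.1 := by
  refine measurable_pi_lambda _ fun i => ?_
  by_cases h : ∃ k, e k = i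
  · obtain ⟨k, rfl⟩ := h
    simp only [he.extend_apply]
    fun_prop
  · simp only [Function.extend_apply' _ _ _ h]
    fun_prop

/-- Replacing the coordinates in the range of `e` by independent fresh ones does not change the
product measure. -/
lemma measurePreserving_extend {ι κ X : Type*} [MeasurableSpace X] (μ : Measure X)
    [IsProbabilityMeasure μ] {e : κ → ι} (he : Function.Injective e) :
    MeasurePreserving (fun p : (ι → X) × (κ → X) => Function.extend e p.2 p.1)
      ((Measure.infinitePi fun _ => μ).prod (Measure.infinitePi fun _ => μ))
      (Measure.infinitePi fun _ => μ) where
  measurable := measurable_extend he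
  map_eq := by
    classical
    refine Measure.eq_infinitePi _ fun s t ht => ?_
    rw [Measure.map_apply (measurable_extend he)
      (.pi s.countable_toSet fun i _ => ht i)]
    have h : (fun p : (ι → X) × (κ → X) => Function.extend e p.2 p.1) ⁻¹' (Set.pi s t) =
        (Set.pi (s.filter fun i => i ∉ Set.range e : Finset ι) t) ×ˢ
          (Set.pi (s.preimage e he.injOn : Finset κ) fun k => t (e k)) := by
      ext ⟨ω, U⟩
      simp only [Set.mem_preimage, Set.mem_pi, Set.mem_prod, Finset.mem_coe, Finset.mem_filter,
        Finset.mem_preimage]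
      constructor
      · refine fun h => ⟨fun i hi => ?_, fun k hk => ?_⟩
        · have := h i hi.1
          rwa [Function.extend_apply' _ _ _ hi.2] at this
        · have := h (e k) hk
          rwa [he.extend_apply] at this
      · rintro ⟨h₁, h₂⟩ i hi
        by_cases hr : i ∈ Set.range e
        · obtain ⟨k, rfl⟩ := hr
          rw [he.extend_apply]
          exact h₂ k hi
        · rw [Function.extend_apply' _ _ _ hr]
          exact h₁ i ⟨hi, hr⟩
    rw [h, Measure.prod_prod, Measure.infinitePi_pi _ fun i _ => ht i,
      Measure.infinitePi_pi _ fun k _ => ht (e k), mul_comm,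
      Finset.prod_preimage' e s he.injOn fun i => μ (t i)]
    exact Finset.prod_filter_mul_prod_filter_not s (fun i => i ∈ Set.range e) fun i => μ (t i)

/-- A measurable property holds almost surely if, however the other coordinates are frozen, it
holds for almost every choice of the coordinates in the range of `e`. -/
lemma ae_of_forall_ae_extend {ι κ X : Type*} [MeasurableSpace X] (μ : Measure X)
    [IsProbabilityMeasure μ] {e : κ → ι} (he : Function.Injective e) {P : (ι → X) → Prop}
    (hP : MeasurableSet {ω | P ω})
    (h : ∀ ω, ∀ᵐ U ∂(Measure.infinitePi fun _ : κ => μ), P (Function.extend e U ω)) :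
    ∀ᵐ ω ∂(Measure.infinitePi fun _ : ι => μ), P ω := by
  rw [← (measurePreserving_extend μ he).map_eq,
    ae_map_iff (measurable_extend he).aemeasurable hP]
  exact (Measure.ae_prod_mem_iff_ae_ae_mem (measurable_extend he hP)).2 (.of_forall h)

/-- Replacing one coordinate by an independent fresh one does not change integrals. -/
lemma integral_integral_update {ι X : Type*} [DecidableEq ι] [MeasurableSpace X] (μ : Measure X)
    [IsProbabilityMeasure μ] (q : ι) {f : (ι → X) → ℝ}
    (hf : Integrable f (Measure.infinitePi fun _ => μ)) :
    ∫ ω, ∫ u, f (Function.update ω q u) ∂μ ∂(Measure.infinitePi fun _ => μ) =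
      ∫ ω, f ω ∂(Measure.infinitePi fun _ => μ) := by
  have he : Function.Injective fun _ : Unit => q := fun _ _ _ => rfl
  have hmp := measurePreserving_extend μ he
  have hu : ∀ (ω : ι → X) (U : Unit → X),
      Function.extend (fun _ : Unit => q) U ω = Function.update ω q (U ()) := by
    intro ω U
    ext i
    by_cases hi : i = q
    · subst hi
      simpa using he.extend_apply U ω ()
    · rw [Function.update_of_ne hi, Function.extend_apply' _ _ _ fun ⟨_, h⟩ => hi h.symm]
  have h2 : Integrable (fun p : (ι → X) × (Unit → X) =>
      f (Function.extend (fun _ : Unit => q) p.2 p.1))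
      ((Measure.infinitePi fun _ => μ).prod (Measure.infinitePi fun _ => μ)) :=
    hmp.integrable_comp_of_integrable hf
  conv_rhs =>
    rw [← hmp.map_eq, integral_map hmp.measurable.aemeasurable
      (by rw [hmp.map_eq]; exact hf.aestronglyMeasurable), integral_prod _ h2]
  refine integral_congr_ae ?_
  have h3 := h2.prod_right_ae
  filter_upwards [h3] with ω hω
  have hev := measurePreserving_eval_infinitePi (fun _ : Unit => μ) ()
  have : (fun U : Unit → X => f (Function.extend (fun _ : Unit => q) U ω)) =
    fun U => (fun u => f (Function.update ω q u)) (Function.eval () U) := by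
      funext U; rw [hu]
  rw [this]
  have hemb : MeasurableEmbedding (Function.eval () : (Unit → X) → X) :=
    (MeasurableEquiv.funUnique Unit X).measurableEmbedding
  exact (hev.integral_comp hemb _).symm

/-! ### A strong law for bounded martingale differences on a product space -/

section StrongLaw

variable {ι X : Type*} [MeasurableSpace X] {μ : Measure X}
  [IsProbabilityMeasure μ] {q : ℕ → ι} {D : ℕ → (ι → X) → ℝ}

lemma integrable_exp_mul_sum (hD : ∀ t, Measurable (D t)) (hb : ∀ t ω, |D t ω| ≤ 1) (l : ℝ)
    (t : ℕ) : Integrable (fun ω => Real.exp (l * ∑ s ∈ Finset.range t, D s ω))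
      (Measure.infinitePi fun _ : ι => μ) := by
  refine Integrable.of_bound (C := Real.exp (|l| * t)) ?_ (.of_forall fun ω => ?_)
  · have : Measurable fun ω => ∑ s ∈ Finset.range t, D s ω :=
      Finset.measurable_fun_sum _ fun s _ => hD s
    exact (this.const_mul l).exp.aestronglyMeasurable
  · rw [Real.norm_eq_abs, Real.abs_exp, Real.exp_le_exp]
    refine (le_abs_self _).trans ?_
    rw [abs_mul]
    refine mul_le_mul_of_nonneg_left ?_ (abs_nonneg _)
    refine (Finset.abs_sum_le_sum_abs _ _).trans ?_
    refine (Finset.sum_le_card_nsmul _ _ 1 fun s _ => hb s ω).trans ?_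
    simp

/-- Each summand multiplies the moment generating function by at most `1 + l ^ 2`, because
`exp x ≤ 1 + x + x ^ 2` for `|x| ≤ 1`. -/
lemma integral_exp_mul_sum_le [DecidableEq ι] (hD : ∀ t, Measurable (D t))
    (hb : ∀ t ω, |D t ω| ≤ 1)
    (hpast : ∀ s t, s < t → ∀ ω u, D s (Function.update ω (q t) u) = D s ω)
    (hmean : ∀ t ω, ∫ u, D t (Function.update ω (q t) u) ∂μ = 0) {l : ℝ} (hl : |l| ≤ 1) (t : ℕ) :
    ∫ ω, Real.exp (l * ∑ s ∈ Finset.range t, D s ω) ∂(Measure.infinitePi fun _ : ι => μ) ≤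
      (1 + l ^ 2) ^ t := by
  induction t with
  | zero => simp
  | succ t ih =>
    rw [← integral_integral_update μ (q t) (integrable_exp_mul_sum hD hb l (t + 1)), pow_succ]
    have hinner : ∀ ω, ∫ u, Real.exp (l * ∑ s ∈ Finset.range (t + 1),
        D s (Function.update ω (q t) u)) ∂μ ≤
          Real.exp (l * ∑ s ∈ Finset.range t, D s ω) * (1 + l ^ 2) := by
      intro ω
      have h1 : ∀ u, Real.exp (l * ∑ s ∈ Finset.range (t + 1), D s (Function.update ω (q t) u)) =
          Real.exp (l * ∑ s ∈ Finset.range t, D s ω) *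
            Real.exp (l * D t (Function.update ω (q t) u)) := by
        intro u
        rw [Finset.sum_range_succ, mul_add, Real.exp_add]
        congr 3
        exact Finset.sum_congr rfl fun s hs => hpast s t (Finset.mem_range.1 hs) ω u
      simp only [h1]
      rw [integral_const_mul]
      refine mul_le_mul_of_nonneg_left ?_ (Real.exp_pos _).le
      have hm : Measurable fun u => D t (Function.update ω (q t) u) :=
        (hD t).comp (measurable_update ω)
      have hi : Integrable (fun u => D t (Function.update ω (q t) u)) μ :=
        .of_bound hm.aestronglyMeasurable 1 (.of_forall fun u => by simpa using hb t _)
      have h2 : ∀ u, Real.exp (l * D t (Function.update ω (q t) u)) ≤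
          1 + l ^ 2 + l * D t (Function.update ω (q t) u) := by
        intro u
        set d := D t (Function.update ω (q t) u)
        have hd : |l * d| ≤ 1 := by
          rw [abs_mul]
          exact mul_le_one₀ hl (abs_nonneg _) (hb t _)
        have h3 := (abs_le.1 (Real.abs_exp_sub_one_sub_id_le hd)).2
        have h4 : (l * d) ^ 2 ≤ l ^ 2 := by
          rw [mul_pow]
          refine mul_le_of_le_one_right (sq_nonneg _) ?_
          rw [sq_le_one_iff_abs_le_one]
          exact hb t _
        linarith
      calc ∫ u, Real.exp (l * D t (Function.update ω (q t) u)) ∂μ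
          ≤ ∫ u, (1 + l ^ 2 + l * D t (Function.update ω (q t) u)) ∂μ := by
            refine integral_mono ?_ ((integrable_const _).add (hi.const_mul l)) h2
            refine .of_bound (C := Real.exp 1) (hm.const_mul l).exp.aestronglyMeasurable
              (.of_forall fun u => ?_)
            rw [Real.norm_eq_abs, Real.abs_exp, Real.exp_le_exp]
            refine (le_abs_self _).trans ?_
            rw [abs_mul]
            exact mul_le_one₀ hl (abs_nonneg _) (hb t _)
        _ = 1 + l ^ 2 := by
            rw [integral_add (integrable_const _) (hi.const_mul l), integral_const_mul, hmean]
            simp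
    calc ∫ ω, ∫ u, Real.exp (l * ∑ s ∈ Finset.range (t + 1),
            D s (Function.update ω (q t) u)) ∂μ ∂(Measure.infinitePi fun _ : ι => μ)
        ≤ ∫ ω, Real.exp (l * ∑ s ∈ Finset.range t, D s ω) * (1 + l ^ 2)
            ∂(Measure.infinitePi fun _ : ι => μ) :=
          integral_mono_of_nonneg
            (.of_forall fun ω => integral_nonneg fun u => (Real.exp_pos _).le)
            ((integrable_exp_mul_sum hD hb l t).mul_const _) (.of_forall hinner)
      _ ≤ (1 + l ^ 2) ^ t * (1 + l ^ 2) := by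
          rw [integral_mul_const]
          exact mul_le_mul_of_nonneg_right ih (by positivity)

/-- By Markov's inequality for the exponential, the probability of `t * δ ≤ ∑ s < t, D s` decreases
geometrically, so Borel--Cantelli applies. -/
lemma ae_eventually_sum_lt [DecidableEq ι] (hD : ∀ t, Measurable (D t))
    (hb : ∀ t ω, |D t ω| ≤ 1)
    (hpast : ∀ s t, s < t → ∀ ω u, D s (Function.update ω (q t) u) = D s ω)
    (hmean : ∀ t ω, ∫ u, D t (Function.update ω (q t) u) ∂μ = 0) {δ : ℝ} (hδ : 0 < δ)
    (hδ1 : δ ≤ 1) :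
    ∀ᵐ ω ∂(Measure.infinitePi fun _ : ι => μ),
      ∀ᶠ t : ℕ in atTop, ∑ s ∈ Finset.range t, D s ω < t * δ := by
  set P := Measure.infinitePi fun _ : ι => μ
  -- `l = δ / 2` minimizes `l ^ 2 - l * δ`
  set l := δ / 2 with hl
  have hl0 : 0 < l := by positivity
  have hl1 : |l| ≤ 1 := by rw [abs_of_pos hl0]; linarith
  set r := Real.exp (-(l ^ 2)) with hr
  have hr1 : r < 1 := by
    rw [hr, Real.exp_lt_one_iff]
    have : 0 < l ^ 2 := by positivity
    linarith
  have hbound : ∀ t : ℕ, P {ω | t * δ ≤ ∑ s ∈ Finset.range t, D s ω} ≤ ENNReal.ofReal (r ^ t) := by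
    intro t
    rw [← ofReal_measureReal]
    refine ENNReal.ofReal_le_ofReal ?_
    have hM := mul_meas_ge_le_integral_of_nonneg
      (.of_forall fun ω => (Real.exp_pos (l * ∑ s ∈ Finset.range t, D s ω)).le)
      (integrable_exp_mul_sum (μ := μ) hD hb l t) (Real.exp (l * (t * δ)))
    simp only [Real.exp_le_exp, mul_le_mul_iff_right₀ hl0] at hM
    have h1 := hM.trans (integral_exp_mul_sum_le hD hb hpast hmean hl1 t)
    have h2 : (1 + l ^ 2) ^ t ≤ Real.exp (t * l ^ 2) := by
      rw [Real.exp_nat_mul]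
      refine pow_le_pow_left₀ (by positivity) ?_ t
      linarith [Real.add_one_le_exp (l ^ 2)]
    have h3 := h1.trans h2
    rw [mul_comm, ← le_div_iff₀ (Real.exp_pos _), ← Real.exp_sub] at h3
    refine h3.trans (le_of_eq ?_)
    rw [hr, ← Real.exp_nat_mul, hl]
    congr 1
    ring
  have hsum : ∑' t : ℕ, P {ω | t * δ ≤ ∑ s ∈ Finset.range t, D s ω} ≠ ⊤ := by
    refine ne_top_of_le_ne_top ?_ (ENNReal.tsum_le_tsum hbound)
    exact (summable_geometric_of_lt_one (Real.exp_pos _).le hr1).tsum_ofReal_ne_top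
  filter_upwards [ae_eventually_notMem hsum] with ω hω
  filter_upwards [hω] with t ht
  simpa using ht

/-- The averages of uniformly bounded martingale differences converge to zero: `D t` has mean zero
in the coordinate `q t`, and does not depend on the later coordinates `q (t + 1), q (t + 2), …`. -/
lemma ae_tendsto_average_zero [DecidableEq ι] (hD : ∀ t, Measurable (D t))
    (hb : ∀ t ω, |D t ω| ≤ 1)
    (hpast : ∀ s t, s < t → ∀ ω u, D s (Function.update ω (q t) u) = D s ω)
    (hmean : ∀ t ω, ∫ u, D t (Function.update ω (q t) u) ∂μ = 0) :
    ∀ᵐ ω ∂(Measure.infinitePi fun _ : ι => μ),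
      Tendsto (fun t : ℕ => (∑ s ∈ Finset.range t, D s ω) / t) atTop (nhds 0) := by
  have h1 : ∀ k : ℕ, ∀ᵐ ω ∂(Measure.infinitePi fun _ : ι => μ),
      ∀ᶠ t : ℕ in atTop, ∑ s ∈ Finset.range t, D s ω < t * (1 / ((k : ℝ) + 1)) := fun k =>
    ae_eventually_sum_lt hD hb hpast hmean (by positivity)
      ((div_le_one (by positivity)).2 (by linarith [(Nat.cast_nonneg k : (0 : ℝ) ≤ k)]))
  have h2 : ∀ k : ℕ, ∀ᵐ ω ∂(Measure.infinitePi fun _ : ι => μ),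
      ∀ᶠ t : ℕ in atTop, ∑ s ∈ Finset.range t, -D s ω < t * (1 / ((k : ℝ) + 1)) := fun k =>
    ae_eventually_sum_lt (D := fun t ω => -D t ω) (fun t => (hD t).neg)
      (fun t ω => by simpa using hb t ω) (fun s t h ω u => by rw [hpast s t h])
      (fun t ω => by rw [integral_neg, hmean, neg_zero]) (by positivity)
      ((div_le_one (by positivity)).2 (by linarith [(Nat.cast_nonneg k : (0 : ℝ) ≤ k)]))
  filter_upwards [ae_all_iff.2 h1, ae_all_iff.2 h2] with ω h1 h2
  rw [Metric.tendsto_atTop']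
  intro η hη
  obtain ⟨k, hk⟩ := exists_nat_one_div_lt hη
  obtain ⟨N, hN⟩ := eventually_atTop.1 ((h1 k).and (h2 k))
  refine ⟨N, fun t ht => ?_⟩
  obtain ⟨h3, h4⟩ := hN t ht.le
  have ht0 : (0 : ℝ) < t := by exact_mod_cast (Nat.zero_le N).trans_lt ht
  rw [Finset.sum_neg_distrib] at h4
  rw [Real.dist_eq, sub_zero, abs_div, Nat.abs_cast, div_lt_iff₀ ht0, mul_comm]
  refine (abs_lt.2 ⟨by linarith, h3⟩).trans ?_
  exact mul_lt_mul_of_pos_left hk ht0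

end StrongLaw

/-! ### The run of SM-MCTS seen from the root and from its children -/

namespace BanditAlgorithm

section Run

variable (A : BanditAlgorithm) {m n : ℕ} (c : Fin (m + 1) → Fin (n + 1) → Game) (ω : Tape)

/-- The reward that the action `i` of player 1 would have earned at the `t`-th visit of the root:
the next sample of the child to which `i` and the actual action of player 2 lead. -/
def hypothetical (i : Fin (m + 1)) (t : ℕ) : ℝ :=
  A.sample c ω i (A.rootAction c ω t).2 (A.uses c ω i (A.rootAction c ω t).2 t)

lemma uses_zero (i : Fin (m + 1)) (j : Fin (n + 1)) : A.uses c ω i j 0 = 0 := by simp [uses]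

lemma uses_succ (i : Fin (m + 1)) (j : Fin (n + 1)) (t : ℕ) :
    A.uses c ω i j (t + 1) =
      A.uses c ω i j t + if A.rootAction c ω t = (i, j) then 1 else 0 := by
  unfold uses
  rw [Finset.range_add_one, Finset.filter_insert]
  split_ifs with h
  · rw [Finset.card_insert_of_notMem (by simp)]
  · rfl

lemma uses_mono (i : Fin (m + 1)) (j : Fin (n + 1)) : Monotone (A.uses c ω i j) :=
  monotone_nat_of_le_succ fun t => by rw [uses_succ]; omega

/-- The part of the tree below the child `(i, j)` is in the state of SM-MCTS run on this child, one
iteration for each use of `(i, j)`. -/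
lemma run_child (T : ℕ) (i : Fin (m + 1)) (j : Fin (n + 1)) :
    (A.run (.node m n c) ω T).2 i j = A.run (c i j) (ω.child i j) (A.uses c ω i j T) := by
  induction T with
  | zero => rw [uses_zero]; rfl
  | succ T ih =>
    have h : (A.run (.node m n c) ω (T + 1)).2 =
        Function.update (A.run (.node m n c) ω T).2 (A.rootAction c ω T).1
          (Function.update ((A.run (.node m n c) ω T).2 (A.rootAction c ω T).1)
            (A.rootAction c ω T).2
            (A.iteration (c (A.rootAction c ω T).1 (A.rootAction c ω T).2)
              (ω.child (A.rootAction c ω T).1 (A.rootAction c ω T).2)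
              ((A.run (.node m n c) ω T).2 (A.rootAction c ω T).1 (A.rootAction c ω T).2)).1) :=
      rfl
    rw [h, uses_succ]
    generalize A.rootAction c ω T = a
    obtain ⟨a₁, a₂⟩ := a
    by_cases hi : i = a₁
    · subst hi
      rw [Function.update_self]
      by_cases hj : j = a₂
      · subst hj
        rw [Function.update_self, ih, if_pos rfl]
        rfl
      · rw [Function.update_of_ne hj, ih, if_neg fun h => hj (Prod.ext_iff.1 h).2.symm, add_zero]
    · rw [Function.update_of_ne hi, ih, if_neg fun h => hi (Prod.ext_iff.1 h).1.symm, add_zero]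

lemma run_root_succ (T : ℕ) :
    (A.run (.node m n c) ω (T + 1)).1 = (A.run (.node m n c) ω T).1 ++
      [((A.rootAction c ω T).1, (A.rootAction c ω T).2, A.payoff (.node m n c) ω T)] := rfl

lemma length_run_root (T : ℕ) : (A.run (.node m n c) ω T).1.length = T := by
  induction T with
  | zero => rfl
  | succ T ih => rw [run_root_succ, List.length_append, ih]; rfl

lemma payoff_node (t : ℕ) :
    A.payoff (.node m n c) ω t =
      A.payoff (c (A.rootAction c ω t).1 (A.rootAction c ω t).2)
        (ω.child (A.rootAction c ω t).1 (A.rootAction c ω t).2)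
        (A.uses c ω (A.rootAction c ω t).1 (A.rootAction c ω t).2 t) := by
  conv_rhs => rw [payoff, ← run_child]
  rfl

lemma hypothetical_rootAction (t : ℕ) :
    A.hypothetical c ω (A.rootAction c ω t).1 t = A.payoff (.node m n c) ω t := by
  rw [payoff_node]; rfl

lemma take_run_root {s T : ℕ} (h : s ≤ T) :
    (A.run (.node m n c) ω T).1.take s = (A.run (.node m n c) ω s).1 := by
  induction T with
  | zero => obtain rfl : s = 0 := by omega
            rfl
  | succ T ih =>
    rcases Nat.lt_or_ge s (T + 1) with h' | h'
    · rw [run_root_succ, List.take_append_of_le_length (by rw [length_run_root]; omega),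
        ih (by omega)]
    · obtain rfl : s = T + 1 := by omega
      exact List.take_of_length_le (length_run_root A c ω _).le

lemma rootAction_eq (t : ℕ) :
    A.rootAction c ω t =
      (A.select m (A.run (.node m n c) ω t).1.view₁ (ω ([], false, t)),
        A.select n (A.run (.node m n c) ω t).1.view₂ (ω ([], true, t))) := by
  rw [rootAction, selectAt, length_run_root]

lemma empirical₂_run (T : ℕ) (j : Fin (n + 1)) :
    (A.run (.node m n c) ω T).1.empirical₂ j =
      (∑ t ∈ Finset.range T, if (A.rootAction c ω t).2 = j then (1 : ℝ) else 0) / T := by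
  rw [Hist.empirical₂, length_run_root]
  congr 1
  induction T with
  | zero => rw [Finset.sum_range_zero, Nat.cast_eq_zero]; rfl
  | succ T ih =>
    rw [run_root_succ, Finset.sum_range_succ, ← ih, List.map_append, List.count_append]
    simp [List.count_singleton]

lemma average₂_run (T : ℕ) (j : Fin (n + 1)) :
    (A.run (.node m n c) ω T).1.average₂ A j =
      (∑ t ∈ Finset.range T, A.prob n (A.run (.node m n c) ω t).1.view₂ j) / T := by
  rw [Hist.average₂, length_run_root]
  congr 1
  refine Finset.sum_congr rfl fun t ht => ?_
  rw [take_run_root A c ω (Finset.mem_range.1 ht).le]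

end Run

/-! ### Measurability of the run -/

section Measurability

variable (A : BanditAlgorithm)

lemma measurable_child (i j : ℕ) : Measurable fun ω : Tape => ω.child i j :=
  measurable_pi_lambda _ fun _ => measurable_pi_apply _

lemma isSimple_selectAt {m n : ℕ} (H : Hist m n) : IsSimple fun ω : Tape => A.selectAt ω H :=
  have h : ∀ q, Measurable fun ω : Tape => ω q := measurable_pi_apply
  .of_measurable <| ((A.measurable_select m _).comp (h _)).prodMk
    ((A.measurable_select n _).comp (h _))

lemma isSimple_iteration : ∀ (G : Game) (S : State G), IsSimple fun ω => A.iteration G ω S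
  | .terminal _, _ => .const _
  | .node m n c, S =>
    (A.isSimple_selectAt S.1).bind (g := fun a ω =>
      let r := A.iteration (c a.1 a.2) (ω.child a.1 a.2) (S.2 a.1 a.2)
      (((S.1 ++ [(a.1, a.2, r.2)],
        Function.update S.2 a.1 (Function.update (S.2 a.1) a.2 r.1)), r.2) :
          State (.node m n c) × I)) fun a =>
      ((isSimple_iteration (c a.1 a.2) (S.2 a.1 a.2)).comp (measurable_child a.1 a.2)).map
        fun r => (((S.1 ++ [(a.1, a.2, r.2)],
          Function.update S.2 a.1 (Function.update (S.2 a.1) a.2 r.1)), r.2) :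
            State (.node m n c) × I)

lemma isSimple_run (G : Game) : ∀ T, IsSimple fun ω => A.run G ω T
  | 0 => .const _
  | T + 1 => ((isSimple_run G T).bind fun S => A.isSimple_iteration G S).map Prod.fst

lemma isSimple_payoff (G : Game) (t : ℕ) : IsSimple fun ω => A.payoff G ω t :=
  ((A.isSimple_run G t).bind fun S => A.isSimple_iteration G S).map Prod.snd

variable {m n : ℕ} (c : Fin (m + 1) → Fin (n + 1) → Game)

lemma isSimple_rootAction (t : ℕ) : IsSimple fun ω => A.rootAction c ω t :=
  (A.isSimple_run (.node m n c) t).bind fun S => A.isSimple_selectAt S.1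

lemma isSimple_uses (i : Fin (m + 1)) (j : Fin (n + 1)) : ∀ t, IsSimple fun ω => A.uses c ω i j t
  | 0 => by simpa only [uses_zero] using .const 0
  | t + 1 => by
    simp only [uses_succ]
    exact (isSimple_uses i j t).bind fun k =>
      (A.isSimple_rootAction c t).map fun a => k + if a = (i, j) then 1 else 0

lemma isSimple_hypothetical (i : Fin (m + 1)) (t : ℕ) :
    IsSimple fun ω => A.hypothetical c ω i t :=
  (A.isSimple_rootAction c t).bind (g := fun (a : Fin (m + 1) × Fin (n + 1)) ω =>
      A.sample c ω i a.2 (A.uses c ω i a.2 t)) fun a =>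
    (A.isSimple_uses c i a.2 t).bind fun k =>
      ((A.isSimple_payoff (c i a.2) k).comp (measurable_child i a.2)).map fun x => (x : ℝ)

end Measurability

end BanditAlgorithm

/-! ### Hannan consistency at the root -/

namespace BanditAlgorithm

section Regret

variable (A : BanditAlgorithm) {m n : ℕ} (c : Fin (m + 1) → Fin (n + 1) → Game) (ω : Tape)

/-- The reward for the action `i` of player 1 in the next iteration, when the tree contains `S`. -/
def rewardOf (S : State (.node m n c)) (i : Fin (m + 1)) : I :=
  (A.iteration (c i (A.selectAt ω S.1).2) (ω.child i (A.selectAt ω S.1).2)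
    (S.2 i (A.selectAt ω S.1).2)).2

/-- One iteration of SM-MCTS in which the joint action `a` is selected at the root. -/
def stepWith (S : State (.node m n c)) (a : Fin (m + 1) × Fin (n + 1)) : State (.node m n c) :=
  (S.1 ++ [(a.1, a.2, (A.iteration (c a.1 a.2) (ω.child a.1 a.2) (S.2 a.1 a.2)).2)],
    Function.update S.2 a.1 (Function.update (S.2 a.1) a.2
      (A.iteration (c a.1 a.2) (ω.child a.1 a.2) (S.2 a.1 a.2)).1))

lemma run_succ (T : ℕ) : A.run (.node m n c) ω (T + 1) =
    A.stepWith c ω (A.run (.node m n c) ω T) (A.rootAction c ω T) := rfl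

lemma stepWith_congr {ω ω' : Tape} (hc : ∀ i j, ω'.child i j = ω.child i j)
    (S : State (.node m n c)) (a : Fin (m + 1) × Fin (n + 1)) :
    A.stepWith c ω' S a = A.stepWith c ω S a := by
  simp only [stepWith, hc]
  rfl

/-- One iteration of SM-MCTS in which player 1 is forced to select `i` at the root. -/
def forcedStep (S : State (.node m n c)) (i : Fin (m + 1)) : State (.node m n c) :=
  A.stepWith c ω S (i, (A.selectAt ω S.1).2)

/-- Contents of the tree after player 1 has been forced to select the listed actions at the root. -/
def forcedRun (l : List (Fin (m + 1))) : State (.node m n c) :=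
  l.foldl (A.forcedStep c ω) (NodeMap.const (fun _ _ => []) (.node m n c))

/-- The adversary that player 1 faces at the root: everything except the random numbers of player 1
at the root is fixed to its value in `ω`, so that the rewards are a function of the past actions of
player 1. -/
def adversary (l : List (Fin (m + 1))) (i : Fin (m + 1)) : I :=
  A.rewardOf c ω (A.forcedRun c ω l) i

variable {ω} {ω' : Tape} {U : ℕ → I}

/-- If `ω'` is `ω` with the random numbers of player 1 at the root replaced by `U`, then SM-MCTS
on `ω'` is, for player 1 at the root, a bandit problem against `adversary`. -/
lemma banditHist_adversary (hc : ∀ i j, ω'.child i j = ω.child i j)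
    (ht : ∀ t, ω' ([], true, t) = ω ([], true, t)) (hf : ∀ t, ω' ([], false, t) = U t) (t : ℕ) :
    A.banditHist (A.adversary c ω) U t = (A.run (.node m n c) ω' t).1.view₁ ∧
      A.forcedRun c ω ((A.banditHist (A.adversary c ω) U t).map Prod.fst) =
        A.run (.node m n c) ω' t := by
  induction t with
  | zero => exact ⟨rfl, rfl⟩
  | succ t ih =>
    have hsel : A.selectAt ω' (A.run (.node m n c) ω' t).1 =
        (A.select m (A.run (.node m n c) ω' t).1.view₁ (U t),
          (A.selectAt ω (A.run (.node m n c) ω' t).1).2) := by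
      unfold selectAt
      rw [length_run_root, hf, ht]
    have hstep : A.run (.node m n c) ω' (t + 1) =
        A.forcedStep c ω (A.run (.node m n c) ω' t)
          (A.select m (A.run (.node m n c) ω' t).1.view₁ (U t)) := by
      rw [run_succ, stepWith_congr A c hc, rootAction, hsel, forcedStep]
    have hH : A.banditHist (A.adversary c ω) U (t + 1) =
        A.banditHist (A.adversary c ω) U t ++
          [(A.select m (A.banditHist (A.adversary c ω) U t) (U t),
            A.adversary c ω ((A.banditHist (A.adversary c ω) U t).map Prod.fst)
              (A.select m (A.banditHist (A.adversary c ω) U t) (U t)))] := rfl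
    rw [hH]
    constructor
    · rw [hstep, adversary, ih.2, ih.1]
      simp [forcedStep, stepWith, rewardOf, Hist.view₁]
    · rw [List.map_append, forcedRun, List.foldl_append, ← forcedRun, ih.2, hstep, ih.1]
      rfl

lemma banditAction_adversary (hc : ∀ i j, ω'.child i j = ω.child i j)
    (ht : ∀ t, ω' ([], true, t) = ω ([], true, t)) (hf : ∀ t, ω' ([], false, t) = U t) (t : ℕ) :
    A.banditAction (A.adversary c ω) U t = (A.rootAction c ω' t).1 := by
  rw [banditAction, (A.banditHist_adversary c hc ht hf t).1, rootAction_eq, hf]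

lemma banditReward_adversary (hc : ∀ i j, ω'.child i j = ω.child i j)
    (ht : ∀ t, ω' ([], true, t) = ω ([], true, t)) (hf : ∀ t, ω' ([], false, t) = U t) (t : ℕ)
    (i : Fin (m + 1)) :
    A.banditReward (A.adversary c ω) U t i = A.hypothetical c ω' i t := by
  have hj : (A.selectAt ω (A.run (.node m n c) ω' t).1).2 = (A.rootAction c ω' t).2 := by
    rw [rootAction]
    unfold selectAt
    rw [length_run_root, ht]
  rw [banditReward, adversary, (A.banditHist_adversary c hc ht hf t).2, rewardOf, hj, hypothetical,
    sample, payoff, ← run_child, hc]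

variable {A}

/-- The average regret of player 1 at the root, compared with the hypothetical rewards, is
asymptotically at most `ε`. -/
lemma IsHannanConsistent.ae_limsup_le {ε : ℝ} (hA : A.IsHannanConsistent ε) :
    ∀ᵐ ω ∂tapeMeasure, limsup (fun t : ℕ =>
      ((⨆ i, ∑ s ∈ Finset.range t, A.hypothetical c ω i s) -
        ∑ s ∈ Finset.range t, (A.payoff (.node m n c) ω s : ℝ)) / t) atTop ≤ ε := by
  have he : Function.Injective fun t : ℕ => (([], false, t) : List (ℕ × ℕ) × Bool × ℕ) :=
    fun s t h => by simpa using h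
  refine ae_of_forall_ae_extend volume he ?_ fun ω => ?_
  · refine measurableSet_le (Measurable.limsup fun t => Measurable.div_const ?_ _)
      measurable_const
    refine Measurable.sub (Measurable.iSup fun i => ?_) ?_
    · exact Finset.measurable_fun_sum _ fun s _ => (A.isSimple_hypothetical c i s).measurable
    · exact Finset.measurable_fun_sum _ fun s _ =>
        ((A.isSimple_payoff _ s).map fun x => (x : ℝ)).measurable
  · filter_upwards [hA m (A.adversary c ω)] with U hU
    set ω' : Tape := Function.extend (fun t : ℕ => (([], false, t) : List (ℕ × ℕ) × Bool × ℕ)) U ω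
    have hc : ∀ i j, ω'.child i j = Tape.child ω i j := fun i j => funext fun q =>
      Function.extend_apply' _ _ _ fun ⟨t, h⟩ => List.cons_ne_nil _ _ (Prod.ext_iff.1 h).1.symm
    have ht : ∀ t, ω' ([], true, t) = ω ([], true, t) := fun t =>
      Function.extend_apply' _ _ _ fun ⟨t, h⟩ => by simp at h
    have hf : ∀ t, ω' ([], false, t) = U t := fun t => he.extend_apply U ω t
    have hr := A.banditReward_adversary c hc ht hf
    have ha := A.banditAction_adversary c hc ht hf
    simp only [regret, hr, ha, hypothetical_rootAction] at hU
    exact hU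

lemma sample_mem (A : BanditAlgorithm) (ω : Tape) (i : Fin (m + 1)) (j : Fin (n + 1)) (k : ℕ) :
    A.sample c ω i j k ∈ Set.Icc (0 : ℝ) 1 := (A.payoff (c i j) (ω.child i j) k).2

/-- In hindsight, no fixed action of player 1 would have been better by more than `ε`. -/
lemma IsHannanConsistent.ae_eventually_le {ε : ℝ} (hA : A.IsHannanConsistent ε) :
    ∀ᵐ ω ∂tapeMeasure, ∀ η : ℝ, 0 < η → ∀ᶠ T : ℕ in atTop, ∀ i,
      (∑ t ∈ Finset.range T, A.hypothetical c ω i t) / T ≤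
        (∑ t ∈ Finset.range T, (A.payoff (.node m n c) ω t : ℝ)) / T + ε + η := by
  filter_upwards [hA.ae_limsup_le c] with ω hω η hη
  have hb : IsBoundedUnder (· ≤ ·) atTop fun t : ℕ =>
      ((⨆ i, ∑ s ∈ Finset.range t, A.hypothetical c ω i s) -
        ∑ s ∈ Finset.range t, (A.payoff (.node m n c) ω s : ℝ)) / t := by
    refine isBoundedUnder_of ⟨1, fun t => div_le_one_of_le₀ ?_ (Nat.cast_nonneg t)⟩
    have h1 : (⨆ i, ∑ s ∈ Finset.range t, A.hypothetical c ω i s) ≤ t :=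
      ciSup_le fun i => (Finset.sum_le_card_nsmul _ _ 1
        fun s _ => (sample_mem c A ω _ _ _).2).trans (by simp)
    have h2 : 0 ≤ ∑ s ∈ Finset.range t, (A.payoff (.node m n c) ω s : ℝ) :=
      Finset.sum_nonneg fun s _ => (A.payoff _ ω s).2.1
    linarith
  filter_upwards [eventually_lt_of_limsup_lt (hω.trans_lt (lt_add_of_pos_right ε hη)) hb]
    with T hT i
  have h1 : (∑ t ∈ Finset.range T, A.hypothetical c ω i t) ≤
      ⨆ i, ∑ s ∈ Finset.range T, A.hypothetical c ω i s :=
    le_ciSup (f := fun i => ∑ s ∈ Finset.range T, A.hypothetical c ω i s)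
      (Set.finite_range _).bddAbove i
  have h2 := div_le_div_of_nonneg_right h1 (Nat.cast_nonneg (α := ℝ) T)
  rw [sub_div] at hT
  linarith

end Regret

/-! ### Average strategies and empirical frequencies -/

section Average

variable (A : BanditAlgorithm) {m n : ℕ} (c : Fin (m + 1) → Fin (n + 1) → Game)

/-- The first `T` iterations do not use the random numbers of the later visits of the root. -/
lemma run_congr {ω ω' : Tape} (hc : ∀ i j, ω'.child i j = ω.child i j) (T : ℕ)
    (h : ∀ b, ∀ t < T, ω' ([], b, t) = ω ([], b, t)) :
    A.run (.node m n c) ω' T = A.run (.node m n c) ω T := by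
  induction T with
  | zero => rfl
  | succ T ih =>
    have hsel : A.selectAt ω' (A.run (.node m n c) ω T).1 =
        A.selectAt ω (A.run (.node m n c) ω T).1 := by
      unfold selectAt
      rw [length_run_root, h _ _ T.lt_succ_self, h _ _ T.lt_succ_self]
    rw [run_succ, run_succ, stepWith_congr A c hc, rootAction, rootAction,
      ih fun b t ht => h b t (ht.trans T.lt_succ_self), hsel]

lemma child_update (ω : Tape) (b : Bool) (t : ℕ) (u : I) (i j : ℕ) :
    Tape.child (Function.update ω ([], b, t) u) i j = ω.child i j :=
  funext fun q => Function.update_of_ne (by simp) _ _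

lemma run_update (ω : Tape) (b : Bool) {s t : ℕ} (h : s ≤ t) (u : I) :
    A.run (.node m n c) (Function.update ω ([], b, t) u) s = A.run (.node m n c) ω s :=
  A.run_congr c (child_update ω b t u) s fun b' s' hs => Function.update_of_ne
    (fun h => by simp only [Prod.mk.injEq, true_and] at h; omega) _ _

lemma prob_mem (k : ℕ) (H : List (Fin (k + 1) × I)) (i : Fin (k + 1)) :
    A.prob k H i ∈ Set.Icc (0 : ℝ) 1 := ⟨measureReal_nonneg, measureReal_le_one⟩

lemma integral_indicator_select (k : ℕ) (H : List (Fin (k + 1) × I)) (i : Fin (k + 1)) :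
    ∫ u : I, (if A.select k H u = i then (1 : ℝ) else 0) = A.prob k H i := by
  have hm : MeasurableSet {u | A.select k H u = i} :=
    A.measurable_select k H (measurableSet_singleton i)
  have : (fun u : I => if A.select k H u = i then (1 : ℝ) else 0) =
      Set.indicator {u | A.select k H u = i} fun _ => 1 := by
    ext u; simp [Set.indicator_apply]
  rw [this, integral_indicator_const _ hm]
  simp [prob]

lemma sum_prob (k : ℕ) (H : List (Fin (k + 1) × I)) : ∑ i, A.prob k H i = 1 := by
  have h : ∀ i, Integrable (fun u : I => if A.select k H u = i then (1 : ℝ) else 0) := fun i =>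
    .of_bound (Measurable.ite (A.measurable_select k H (measurableSet_singleton i))
      measurable_const measurable_const).aestronglyMeasurable 1
      (.of_forall fun u => by split_ifs <;> simp)
  simp only [← integral_indicator_select]
  rw [← integral_finsetSum _ fun i _ => h i]
  simp

/-- The average strategies and the empirical frequencies of player 2 at the root have the same
limiting behavior. -/
lemma ae_tendsto_empirical_sub_average (j : Fin (n + 1)) :
    ∀ᵐ ω ∂tapeMeasure, Tendsto (fun T : ℕ => (A.run (.node m n c) ω T).1.empirical₂ j -
      (A.run (.node m n c) ω T).1.average₂ A j) atTop (nhds 0) := by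
  have key := ae_tendsto_average_zero (μ := (volume : Measure I))
    (q := fun t : ℕ => (([], true, t) : List (ℕ × ℕ) × Bool × ℕ))
    (D := fun t ω => (if (A.rootAction c ω t).2 = j then (1 : ℝ) else 0) -
      A.prob n (A.run (.node m n c) ω t).1.view₂ j) ?_ ?_ ?_ ?_
  · filter_upwards [key] with ω hω
    simpa only [empirical₂_run, average₂_run, ← sub_div, ← Finset.sum_sub_distrib] using hω
  · intro t
    exact (((A.isSimple_rootAction c t).map fun a => if a.2 = j then (1 : ℝ) else 0).measurable).sub
      (((A.isSimple_run (.node m n c) t).map fun S =>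
        A.prob n (Hist.view₂ S.1) j).measurable)
  · intro t ω
    have h := A.prob_mem n (A.run (.node m n c) ω t).1.view₂ j
    rw [abs_le]
    split_ifs <;> constructor <;> linarith [h.1, h.2]
  · intro s t hst ω u
    have h : A.rootAction c (Function.update ω ([], true, t) u) s = A.rootAction c ω s := by
      have hne : ∀ b : Bool, (([], b, s) : List (ℕ × ℕ) × Bool × ℕ) ≠ ([], true, t) := by
        intro b h
        simp only [Prod.mk.injEq, true_and] at h
        omega
      rw [rootAction_eq, rootAction_eq, run_update A c ω true hst.le, Function.update_of_ne (hne _),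
        Function.update_of_ne (hne _)]
    simp only [h, run_update A c ω true hst.le]
  · intro t ω
    have h : ∀ u, (A.rootAction c (Function.update ω ([], true, t) u) t).2 =
        A.select n (A.run (.node m n c) ω t).1.view₂ u := by
      intro u
      rw [rootAction_eq, run_update A c ω true le_rfl]
      simp only [Function.update_self]
    simp only [h, run_update A c ω true le_rfl]
    rw [integral_sub _ (integrable_const _), integral_indicator_select]
    · simp
    · exact .of_bound (Measurable.ite (A.measurable_select n _ (measurableSet_singleton j))
        measurable_const measurable_const).aestronglyMeasurable 1
        (.of_forall fun u => by split_ifs <;> simp)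

end Average

end BanditAlgorithm

/-! ### Hypothetical rewards as weighted sums of samples -/

namespace BanditAlgorithm

section Blocks

variable (A : BanditAlgorithm) {m n : ℕ} (c : Fin (m + 1) → Fin (n + 1) → Game) (ω : Tape)
  {i : Fin (m + 1)} {j : Fin (n + 1)}

variable {A c ω}

lemma exists_uses_eq (h : Tendsto (fun t => A.uses c ω i j t) atTop atTop) (k : ℕ) :
    ∃ t, A.uses c ω i j t = k := by
  induction k with
  | zero => exact ⟨0, uses_zero A c ω i j⟩
  | succ k ih =>
    -- the last time with at most `k` uses is followed by a use
    obtain ⟨N, hN⟩ := eventually_atTop.1 (h.eventually_ge_atTop (k + 1))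
    have hex : ∃ t, k + 1 ≤ A.uses c ω i j t := ⟨N, hN N le_rfl⟩
    refine ⟨Nat.find hex, le_antisymm ?_ (Nat.find_spec hex)⟩
    rcases hf : Nat.find hex with _ | t
    · rw [uses_zero]; omega
    · have h1 := Nat.find_min hex (m := t) (by omega)
      rw [uses_succ]
      split_ifs <;> omega

lemma uses_useTime (h : Tendsto (fun t => A.uses c ω i j t) atTop atTop) (k : ℕ) :
    A.uses c ω i j (A.useTime c ω i j k) = k :=
  Nat.sInf_mem (s := {t | A.uses c ω i j t = k}) (exists_uses_eq h k)

lemma useTime_le_iff (h : Tendsto (fun t => A.uses c ω i j t) atTop atTop) (k t : ℕ) :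
    A.useTime c ω i j k ≤ t ↔ k ≤ A.uses c ω i j t := by
  refine ⟨fun h' => (uses_useTime h k).symm.le.trans (uses_mono A c ω i j h'), fun h' => ?_⟩
  by_contra! hlt
  have h1 : A.uses c ω i j t ≤ k := (uses_mono A c ω i j hlt.le).trans (uses_useTime h k).le
  exact (Nat.sInf_le (le_antisymm h1 h') : A.useTime c ω i j k ≤ t).not_gt hlt

/-- `weight k` counts the visits after exactly `k` uses of `(i, j)` at which player 2 selects
`j`: the summand `1` in its definition stands for the next use of `(i, j)`. -/
lemma weight_eq (h : Tendsto (fun t => A.uses c ω i j t) atTop atTop) (k : ℕ) :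
    A.weight c ω i j k =
      Set.ncard {t | A.uses c ω i j t = k ∧ (A.rootAction c ω t).2 = j} := by
  have hblock : ∀ t, (A.useTime c ω i j k ≤ t ∧ t < A.useTime c ω i j (k + 1)) ↔
      A.uses c ω i j t = k := by
    intro t
    rw [← not_le, useTime_le_iff h, useTime_le_iff h]
    omega
  obtain ⟨τ, hτ⟩ : ∃ τ, A.useTime c ω i j (k + 1) = τ + 1 := by
    refine Nat.exists_eq_succ_of_ne_zero fun h0 => ?_
    have := uses_useTime h (k + 1)
    rw [h0, uses_zero] at this
    omega
  have hτk : A.uses c ω i j τ ≤ k := by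
    by_contra! hlt
    have := (useTime_le_iff h (k + 1) τ).2 hlt
    omega
  have hτ' := uses_useTime h (k + 1)
  rw [hτ, uses_succ] at hτ'
  have hact : A.rootAction c ω τ = (i, j) := by
    by_contra hne
    rw [if_neg hne] at hτ'
    omega
  rw [if_pos hact] at hτ'
  have hset : {t | A.uses c ω i j t = k ∧ (A.rootAction c ω t).2 = j} =
      insert τ {t | A.useTime c ω i j k ≤ t ∧ t < A.useTime c ω i j (k + 1) ∧
        (A.rootAction c ω t).2 = j ∧ (A.rootAction c ω t).1 ≠ i} := by
    ext t
    simp only [Set.mem_ofPred_eq, Set.mem_insert_iff]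
    constructor
    · rintro ⟨h1, h2⟩
      by_cases hi : (A.rootAction c ω t).1 = i
      · left
        have h3 : A.rootAction c ω t = (i, j) := Prod.ext hi h2
        have h4 : k + 1 ≤ A.uses c ω i j (t + 1) := by rw [uses_succ, if_pos h3, h1]
        have h5 := (useTime_le_iff h _ _).2 h4
        have h6 := ((hblock t).2 h1).2
        omega
      · exact .inr ⟨((hblock t).2 h1).1, ((hblock t).2 h1).2, h2, hi⟩
    · rintro (rfl | ⟨h1, h2, h3, -⟩)
      · exact ⟨by omega, by rw [hact]⟩
      · exact ⟨(hblock t).1 ⟨h1, h2⟩, h3⟩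
  rw [hset, Set.ncard_insert_of_notMem (fun h => h.2.2.2 (by rw [hact]))
    ((Set.finite_Iio (A.useTime c ω i j (k + 1))).subset fun t ht => ht.2.1), weight, add_comm]

lemma weight_pos (k : ℕ) : 0 < A.weight c ω i j k := by
  rw [weight]
  omega

lemma finite_block (h : Tendsto (fun t => A.uses c ω i j t) atTop atTop) (k : ℕ) :
    {t | A.uses c ω i j t = k ∧ (A.rootAction c ω t).2 = j}.Finite := by
  refine (Set.finite_Iio (A.useTime c ω i j (k + 1))).subset fun t ht => ?_
  rw [Set.mem_Iio, ← not_le, useTime_le_iff h, ht.1]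
  omega

lemma card_block_le (h : Tendsto (fun t => A.uses c ω i j t) atTop atTop) (T k : ℕ) :
    {t ∈ Finset.range T | A.uses c ω i j t = k ∧ (A.rootAction c ω t).2 = j}.card ≤
      A.weight c ω i j k := by
  rw [weight_eq h, ← Set.ncard_coe_finset]
  refine Set.ncard_le_ncard (fun t ht => ?_) (finite_block h k)
  simpa using (Finset.mem_filter.1 ht).2

lemma card_block (h : Tendsto (fun t => A.uses c ω i j t) atTop atTop) {T k : ℕ}
    (hk : k < A.uses c ω i j T) :
    {t ∈ Finset.range T | A.uses c ω i j t = k ∧ (A.rootAction c ω t).2 = j}.card =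
      A.weight c ω i j k := by
  rw [weight_eq h, ← Set.ncard_coe_finset]
  congr 1
  ext t
  simp only [Finset.coe_filter, Finset.mem_range, Set.mem_ofPred_eq, and_iff_right_iff_imp]
  rintro ⟨rfl, -⟩
  by_contra! hle
  exact absurd (uses_mono A c ω i j hle) (by omega)

/-- Grouping the visits at which player 2 selects `j` by the number of past uses of `(i, j)`. The
last group may be incomplete. -/
lemma sum_visits_eq (h : Tendsto (fun t => A.uses c ω i j t) atTop atTop) (f : ℕ → ℝ) (T : ℕ) :
    (∑ t ∈ Finset.range T, if (A.rootAction c ω t).2 = j then f (A.uses c ω i j t) else 0) =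
      (∑ k ∈ Finset.range (A.uses c ω i j T), A.weight c ω i j k * f k) +
        {t ∈ Finset.range T | A.uses c ω i j t = A.uses c ω i j T ∧
          (A.rootAction c ω t).2 = j}.card * f (A.uses c ω i j T) := by
  have hmaps : ∀ t ∈ Finset.range T,
      A.uses c ω i j t ∈ Finset.range (A.uses c ω i j T + 1) := fun t ht =>
    Finset.mem_range.2 (Nat.lt_succ_of_le (uses_mono A c ω i j (Finset.mem_range.1 ht).le))
  have hfib : ∀ k, (∑ t ∈ Finset.range T with A.uses c ω i j t = k,
      if (A.rootAction c ω t).2 = j then f (A.uses c ω i j t) else 0) =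
        {t ∈ Finset.range T | A.uses c ω i j t = k ∧ (A.rootAction c ω t).2 = j}.card * f k := by
    intro k
    rw [← Finset.sum_filter, Finset.filter_filter, ← nsmul_eq_mul]
    refine Finset.sum_eq_card_nsmul fun t ht => ?_
    rw [(Finset.mem_filter.1 ht).2.1]
  rw [← Finset.sum_fiberwise_of_maps_to hmaps, Finset.sum_range_succ, hfib]
  congr 1
  refine Finset.sum_congr rfl fun k hk => ?_
  rw [hfib, card_block h (Finset.mem_range.1 hk)]

/-- If two consecutive weighted averages of the samples of `(i, j)` are at least `a`, then so is the
average of the hypothetical rewards of `i` over the visits at which player 2 selects `j`, because it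
lies between them. -/
lemma mul_visits_le (h : Tendsto (fun t => A.uses c ω i j t) atTop atTop) {a : ℝ} {T : ℕ}
    (h₀ : A.uses c ω i j T ≠ 0) (h₁ : a ≤ A.weightedAverage c ω i j (A.uses c ω i j T))
    (h₂ : a ≤ A.weightedAverage c ω i j (A.uses c ω i j T + 1)) :
    a * (∑ t ∈ Finset.range T, if (A.rootAction c ω t).2 = j then (1 : ℝ) else 0) ≤
      ∑ t ∈ Finset.range T,
        if (A.rootAction c ω t).2 = j then A.sample c ω i j (A.uses c ω i j t) else 0 := by
  have hw : ∀ N, N ≠ 0 → a ≤ A.weightedAverage c ω i j N →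
      0 ≤ ∑ k ∈ Finset.range N, A.weight c ω i j k * (A.sample c ω i j k - a) := by
    intro N hN ha
    have hpos : (0 : ℝ) < ∑ k ∈ Finset.range N, (A.weight c ω i j k : ℝ) :=
      Finset.sum_pos (fun k _ => by exact_mod_cast weight_pos k) (by simpa using hN)
    rw [weightedAverage, le_div_iff₀ hpos, Finset.mul_sum] at ha
    simp only [mul_sub, Finset.sum_sub_distrib]
    simp only [mul_comm _ a]
    linarith
  have e₁ := hw _ h₀ h₁
  have e₂ := hw _ (Nat.succ_ne_zero _) h₂
  rw [Finset.sum_range_succ] at e₂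
  have key := sum_visits_eq h (fun k => A.sample c ω i j k - a) T
  have hsplit : (∑ t ∈ Finset.range T, if (A.rootAction c ω t).2 = j then
      A.sample c ω i j (A.uses c ω i j t) - a else 0) =
      (∑ t ∈ Finset.range T,
        if (A.rootAction c ω t).2 = j then A.sample c ω i j (A.uses c ω i j t) else 0) -
      a * (∑ t ∈ Finset.range T, if (A.rootAction c ω t).2 = j then (1 : ℝ) else 0) := by
    rw [Finset.mul_sum, ← Finset.sum_sub_distrib]
    refine Finset.sum_congr rfl fun t _ => ?_
    split_ifs <;> ring
  rw [hsplit] at key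
  have hp : (({t ∈ Finset.range T | A.uses c ω i j t = A.uses c ω i j T ∧
      (A.rootAction c ω t).2 = j}.card : ℕ) : ℝ) ≤ A.weight c ω i j (A.uses c ω i j T) := by
    exact_mod_cast card_block_le h T _
  have hp0 : (0 : ℝ) ≤ (({t ∈ Finset.range T | A.uses c ω i j t = A.uses c ω i j T ∧
      (A.rootAction c ω t).2 = j}.card : ℕ) : ℝ) := Nat.cast_nonneg _
  rw [← sub_nonneg, key]
  -- the left-hand side is affine in the size of the last group, so its extremes suffice
  rcases le_total 0 (A.sample c ω i j (A.uses c ω i j T) - a) with hf | hf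
  · exact add_nonneg e₁ (mul_nonneg hp0 hf)
  · exact e₂.trans (add_le_add le_rfl (mul_le_mul_of_nonpos_right hp hf))

lemma sum_hypothetical (T : ℕ) (i : Fin (m + 1)) :
    ∑ t ∈ Finset.range T, A.hypothetical c ω i t =
      ∑ j, ∑ t ∈ Finset.range T,
        if (A.rootAction c ω t).2 = j then A.sample c ω i j (A.uses c ω i j t) else 0 := by
  rw [Finset.sum_comm]
  refine Finset.sum_congr rfl fun t _ => ?_
  rw [Finset.sum_ite_eq]
  simp [hypothetical]

/-- Asymptotic lower bounds `a j` for the weighted averages yield the lower bound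
`∑ j, σ̂₂ j * a j` for the average hypothetical reward of the action `i`. -/
lemma eventually_sum_le_hypothetical
    (h : ∀ j, Tendsto (fun t => A.uses c ω i j t) atTop atTop) {a : Fin (n + 1) → ℝ}
    (ha : ∀ j, ∀ᶠ N in atTop, a j ≤ A.weightedAverage c ω i j N) :
    ∀ᶠ T : ℕ in atTop, ∑ j, (A.run (.node m n c) ω T).1.empirical₂ j * a j ≤
      (∑ t ∈ Finset.range T, A.hypothetical c ω i t) / T := by
  have h1 : ∀ j, ∀ᶠ T in atTop,
      a j * (∑ t ∈ Finset.range T, if (A.rootAction c ω t).2 = j then (1 : ℝ) else 0) ≤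
      ∑ t ∈ Finset.range T,
        if (A.rootAction c ω t).2 = j then A.sample c ω i j (A.uses c ω i j t) else 0 := by
    intro j
    obtain ⟨N, hN⟩ := eventually_atTop.1 (ha j)
    filter_upwards [(h j).eventually_ge_atTop (N + 1)] with T hT
    exact mul_visits_le (h j) (by omega) (hN _ (by omega)) (hN _ (by omega))
  filter_upwards [eventually_all.2 h1] with T hT
  rw [sum_hypothetical, Finset.sum_div]
  refine Finset.sum_le_sum fun j _ => ?_
  rw [empirical₂_run, div_mul_eq_mul_div, mul_comm]
  exact div_le_div_of_nonneg_right (hT j) (Nat.cast_nonneg T)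

end Blocks

end BanditAlgorithm

/-! ### Values of games -/

/-- `v` is a value of the game: at every inner node, the matrix `w` of the values of the children
has value `v`, in the sense that no mixed action of player 2 brings all actions of player 1 below
`v`, and no mixed action of player 1 brings all actions of player 2 above `v`. -/
def IsValue : Game → ℝ → Prop
  | .terminal u, v => v = u
  | .node m n c, v => ∃ w : Fin (m + 1) → Fin (n + 1) → ℝ,
      (∀ i j, IsValue (c i j) (w i j)) ∧
      (∀ y ∈ stdSimplex ℝ (Fin (n + 1)), ∃ i, v ≤ ∑ j, y j * w i j) ∧
      (∀ x ∈ stdSimplex ℝ (Fin (m + 1)), ∃ j, ∑ i, x i * w i j ≤ v)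

lemma exists_isValue : ∀ G : Game, ∃ v, IsValue G v
  | .terminal u => ⟨u, rfl⟩
  | .node m n c => by
    choose w hw using fun i j => exists_isValue (c i j)
    have hcont : Continuous fun y : Fin (n + 1) → ℝ =>
        Finset.univ.sup' Finset.univ_nonempty fun i => ∑ j, y j * w i j :=
      Continuous.finset_sup'_apply _ fun i _ => by fun_prop
    obtain ⟨y, hy, hmin⟩ := (isCompact_stdSimplex ℝ (Fin (n + 1))).exists_isMinOn
      ⟨_, single_mem_stdSimplex ℝ 0⟩ hcont.continuousOn
    refine ⟨Finset.univ.sup' Finset.univ_nonempty fun i => ∑ j, y j * w i j, w, hw,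
      fun y' hy' => ?_, fun x hx => ?_⟩
    · obtain ⟨i, -, hi⟩ := Finset.exists_mem_eq_sup' Finset.univ_nonempty
        fun i => ∑ j, y' j * w i j
      exact ⟨i, (hmin hy').trans hi.le⟩
    · -- weak duality
      by_contra! hlt
      set v := Finset.univ.sup' Finset.univ_nonempty fun i => ∑ j, y j * w i j
      have h1 : ∑ i, x i * ∑ j, y j * w i j ≤ v := by
        calc ∑ i, x i * ∑ j, y j * w i j ≤ ∑ i, x i * v :=
              Finset.sum_le_sum fun i _ => mul_le_mul_of_nonneg_left
                (Finset.le_sup' (fun i => ∑ j, y j * w i j) (Finset.mem_univ i)) (hx.1 i)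
          _ = v := by rw [← Finset.sum_mul, hx.2, one_mul]
      have h2 : v < ∑ j, y j * ∑ i, x i * w i j := by
        obtain ⟨j₀, hj₀⟩ : ∃ j, 0 < y j := by
          by_contra! h
          have := hy.2
          rw [Finset.sum_eq_zero fun j _ => le_antisymm (h j) (hy.1 j)] at this
          exact zero_ne_one this
        calc v = ∑ j, y j * v := by rw [← Finset.sum_mul, hy.2, one_mul]
          _ < _ := Finset.sum_lt_sum
            (fun j _ => mul_le_mul_of_nonneg_left (hlt j).le (hy.1 j))
            ⟨j₀, Finset.mem_univ _, mul_lt_mul_of_pos_left (hlt j₀) hj₀⟩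
      have h3 : ∑ i, x i * ∑ j, y j * w i j = ∑ j, y j * ∑ i, x i * w i j := by
        simp only [Finset.mul_sum]
        rw [Finset.sum_comm]
        exact Finset.sum_congr rfl fun j _ => Finset.sum_congr rfl fun i _ => by ring
      linarith

/-! ### Exchanging the players -/

/-- The game with the roles of the players exchanged. -/
def Game.swap : Game → Game
  | .terminal u => .terminal (unitInterval.symm u)
  | .node m n c => .node n m fun j i => (c i j).swap

/-- The random numbers with the roles of the players exchanged. -/
def Tape.swap (ω : Tape) : Tape := fun q => ω (q.1.map Prod.swap, !q.2.1, q.2.2)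

/-- What is stored at a node, with the roles of the players exchanged. -/
def Hist.swap {m n : ℕ} (H : Hist m n) : Hist n m :=
  H.map fun e => (e.2.1, e.1, unitInterval.symm e.2.2)

/-- Transport of a family along the exchange of the players, applying `f` at every inner node. -/
def NodeMap.swap {F F' : ℕ → ℕ → Type} (f : ∀ m n, F m n → F' n m) :
    (G : Game) → NodeMap F G → NodeMap F' G.swap
  | .terminal _, _ => ()
  | .node m n c, x => (f m n x.1, fun j i => NodeMap.swap f (c i j) (x.2 i j))

lemma Game.depth_swap : ∀ G : Game, G.swap.depth = G.depth
  | .terminal _ => rfl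
  | .node m n c => by
    simp only [Game.swap, Game.depth, fun i j => Game.depth_swap (c i j)]
    rw [Finset.sup_comm]

lemma NodeMap.all_swap {F F' : ℕ → ℕ → Type} {f : ∀ m n, F m n → F' n m}
    {P : ∀ m n, F m n → Prop} {P' : ∀ m n, F' m n → Prop}
    (h : ∀ m n x, P' n m (f m n x) ↔ P m n x) :
    ∀ (G : Game) (x : NodeMap F G), NodeMap.All P' G.swap (NodeMap.swap f G x) ↔ NodeMap.All P G x
  | .terminal _, _ => Iff.rfl
  | .node _ _ c, x => and_congr (h _ _ _)
      ⟨fun hx i j => (NodeMap.all_swap h (c i j) (x.2 i j)).1 (hx j i),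
        fun hx j i => (NodeMap.all_swap h (c i j) (x.2 i j)).2 (hx i j)⟩

lemma NodeMap.map_swap {F₁ F₂ F₃ F₄ : ℕ → ℕ → Type} {f : ∀ m n, F₁ m n → F₂ n m}
    {g : ∀ m n, F₂ m n → F₄ m n} {g' : ∀ m n, F₁ m n → F₃ m n} {f' : ∀ m n, F₃ m n → F₄ n m}
    (h : ∀ m n x, g n m (f m n x) = f' m n (g' m n x)) :
    ∀ (G : Game) (x : NodeMap F₁ G),
      NodeMap.map g G.swap (NodeMap.swap f G x) = NodeMap.swap f' G (NodeMap.map g' G x)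
  | .terminal _, _ => rfl
  | .node _ _ c, x => Prod.ext (h _ _ _) <| funext fun j => funext fun i =>
      NodeMap.map_swap h (c i j) (x.2 i j)

/-- A strategy of player 1 becomes one of player 2. -/
abbrev swapWeights₁ (G : Game) (s : Weights₁ G) : Weights₂ G.swap :=
  NodeMap.swap (fun _ _ p => p) G s

/-- A strategy of player 2 becomes one of player 1. -/
abbrev swapWeights₂ (G : Game) (s : Weights₂ G) : Weights₁ G.swap :=
  NodeMap.swap (fun _ _ p => p) G s

lemma isStrategy₂_swapWeights₁ {G : Game} {s : Weights₁ G} :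
    IsStrategy₂ G.swap (swapWeights₁ G s) ↔ IsStrategy₁ G s :=
  NodeMap.all_swap (fun _ _ _ => Iff.rfl) G s

lemma isStrategy₁_swapWeights₂ {G : Game} {s : Weights₂ G} :
    IsStrategy₁ G.swap (swapWeights₂ G s) ↔ IsStrategy₂ G s :=
  NodeMap.all_swap (fun _ _ _ => Iff.rfl) G s

lemma utility_swap : ∀ (G : Game) (s₁ : Weights₁ G) (s₂ : Weights₂ G), IsStrategy₁ G s₁ →
    IsStrategy₂ G s₂ →
      utility G.swap (swapWeights₂ G s₂) (swapWeights₁ G s₁) = 1 - utility G s₁ s₂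
  | .terminal u, _, _, _, _ => unitInterval.coe_symm_eq u
  | .node m n c, s₁, s₂, h₁, h₂ => by
    have hu : utility (Game.swap (.node m n c)) (swapWeights₂ _ s₂) (swapWeights₁ _ s₁) =
        ∑ j, ∑ i, s₂.1 j * s₁.1 i * utility (c i j).swap (swapWeights₂ _ (s₂.2 i j))
          (swapWeights₁ _ (s₁.2 i j)) := rfl
    have hv : utility (.node m n c) s₁ s₂ =
        ∑ i, ∑ j, s₁.1 i * s₂.1 j * utility (c i j) (s₁.2 i j) (s₂.2 i j) := rfl
    have h1 : ∑ i, ∑ j, s₁.1 i * s₂.1 j = 1 := by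
      rw [← Finset.sum_mul_sum, h₁.1.2, h₂.1.2, one_mul]
    rw [hu, hv, Finset.sum_comm, ← h1, ← Finset.sum_sub_distrib]
    refine Finset.sum_congr rfl fun i _ => ?_
    rw [← Finset.sum_sub_distrib]
    refine Finset.sum_congr rfl fun j _ => ?_
    rw [utility_swap (c i j) _ _ (h₁.2 i j) (h₂.2 i j)]
    ring

lemma IsValue.swap : ∀ {G : Game} {v : ℝ}, IsValue G v → IsValue G.swap (1 - v)
  | .terminal u, v, h => by
    have h' : v = u := h
    rw [h']
    exact (unitInterval.coe_symm_eq u).symm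
  | .node m n c, v, ⟨w, hw, ha, hb⟩ => by
    have hsum : ∀ {k : ℕ} {x : Fin (k + 1) → ℝ}, x ∈ stdSimplex ℝ (Fin (k + 1)) →
        ∀ f : Fin (k + 1) → ℝ, ∑ i, x i * (1 - f i) = 1 - ∑ i, x i * f i := by
      intro k x hx f
      simp only [mul_sub, mul_one, Finset.sum_sub_distrib, hx.2]
    refine ⟨fun j i => 1 - w i j, fun j i => (hw i j).swap, fun x hx => ?_, fun y hy => ?_⟩
    · obtain ⟨j, hj⟩ := hb x hx
      exact ⟨j, by rw [hsum hx]; linarith⟩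
    · obtain ⟨i, hi⟩ := ha y hy
      exact ⟨i, by rw [hsum hy]; linarith⟩

namespace Hist

variable {m n : ℕ} (H : Hist m n)

lemma view₁_swap : H.swap.view₁ = H.view₂ := by simp [Hist.swap, view₁, view₂]

lemma view₂_swap : H.swap.view₂ = H.view₁ := by simp [Hist.swap, view₁, view₂]

lemma length_swap : H.swap.length = H.length := List.length_map _

lemma swap_append (e : Fin (m + 1) × Fin (n + 1) × I) :
    Hist.swap (H ++ [e]) = H.swap ++ [(e.2.1, e.1, unitInterval.symm e.2.2)] :=
  List.map_append

lemma empirical₂_swap : H.swap.empirical₂ = H.empirical₁ := by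
  funext i
  simp [Hist.swap, empirical₁, empirical₂, Function.comp_def]

lemma average₂_swap (A : BanditAlgorithm) : H.swap.average₂ A = H.average₁ A := by
  funext i
  have h : ∀ s, List.take s H.swap = Hist.swap (List.take s H) := fun s => (List.map_take ..).symm
  simp only [average₁, average₂, length_swap, h, view₂_swap]

end Hist

namespace BanditAlgorithm

variable (A : BanditAlgorithm)

lemma selectAt_swap {m n : ℕ} (ω : Tape) (H : Hist m n) :
    A.selectAt ω.swap H.swap = (A.selectAt ω H).swap := by
  unfold selectAt
  rw [Hist.view₁_swap, Hist.view₂_swap, Hist.length_swap]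
  rfl

lemma iteration_swap : ∀ (G : Game) (ω : Tape) (S : State G),
    A.iteration G.swap ω.swap (NodeMap.swap (fun _ _ => Hist.swap) G S) =
      (NodeMap.swap (fun _ _ => Hist.swap) G (A.iteration G ω S).1,
        unitInterval.symm (A.iteration G ω S).2)
  | .terminal _, _, _ => rfl
  | .node m n c, ω, S => by
    have ih := fun i j => iteration_swap (c i j) (ω.child i j) (S.2 i j)
    have hsel : A.selectAt ω.swap (NodeMap.swap (fun _ _ => Hist.swap) (.node m n c) S).1 =
        (A.selectAt ω S.1).swap := A.selectAt_swap ω S.1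
    have hit : ∀ (c' : Fin (n + 1) → Fin (m + 1) → Game) (ω' : Tape) (S' : State (.node n m c'))
        (a : Fin (n + 1) × Fin (m + 1)), A.selectAt ω' S'.1 = a →
        A.iteration (.node n m c') ω' S' = (A.stepWith c' ω' S' a,
          (A.iteration (c' a.1 a.2) (ω'.child a.1 a.2) (S'.2 a.1 a.2)).2) := by
      rintro c' ω' S' _ rfl
      rfl
    have h1 := hit (fun j i => (c i j).swap) ω.swap
      (NodeMap.swap (fun _ _ => Hist.swap) (.node m n c) S) _ hsel
    have h2 : A.iteration (.node m n c) ω S = (A.stepWith c ω S (A.selectAt ω S.1),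
      (A.iteration (c (A.selectAt ω S.1).1 (A.selectAt ω S.1).2)
        (ω.child (A.selectAt ω S.1).1 (A.selectAt ω S.1).2)
        (S.2 (A.selectAt ω S.1).1 (A.selectAt ω S.1).2)).2) := rfl
    rw [h2]
    refine h1.trans ?_
    generalize A.selectAt ω S.1 = a
    obtain ⟨i, j⟩ := a
    have hij : A.iteration (c i j).swap (ω.swap.child j i)
        ((NodeMap.swap (fun _ _ => Hist.swap) (.node m n c) S).2 j i) = _ := ih i j
    refine Prod.ext (Prod.ext ?_ ?_) ?_
    · have : (A.stepWith (fun j i => (c i j).swap) ω.swap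
          (NodeMap.swap (fun _ _ => Hist.swap) (.node m n c) S) (j, i)).1 =
        Hist.swap S.1 ++ [(j, i, (A.iteration (c i j).swap (ω.swap.child j i)
        ((NodeMap.swap (fun _ _ => Hist.swap) (.node m n c) S).2 j i)).2)] := rfl
      refine this.trans ?_
      rw [hij]
      exact (Hist.swap_append S.1 (i, j, (A.iteration (c i j) (ω.child i j) (S.2 i j)).2)).symm
    · funext j' i'
      have h3 : (A.stepWith (fun j i => (c i j).swap) ω.swap
          (NodeMap.swap (fun _ _ => Hist.swap) (.node m n c) S) (j, i)).2 =
        Function.update (NodeMap.swap (fun _ _ => Hist.swap) (.node m n c) S).2 j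
          (Function.update ((NodeMap.swap (fun _ _ => Hist.swap) (.node m n c) S).2 j) i
            (A.iteration (c i j).swap (ω.swap.child j i)
              ((NodeMap.swap (fun _ _ => Hist.swap) (.node m n c) S).2 j i)).1) := rfl
      have h4 : (NodeMap.swap (fun _ _ => Hist.swap) (.node m n c)
          (A.stepWith c ω S (i, j))).2 j' i' =
        NodeMap.swap (fun _ _ => Hist.swap) (c i' j')
          (Function.update S.2 i (Function.update (S.2 i) j
            (A.iteration (c i j) (ω.child i j) (S.2 i j)).1) i' j') := rfl
      refine (congrFun (congrFun h3 j') i').trans (Eq.trans ?_ h4.symm)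
      rw [hij]
      by_cases hj : j' = j
      · subst hj
        rw [Function.update_self]
        by_cases hi : i' = i
        · subst hi
          simp only [Function.update_self]
        · rw [Function.update_of_ne hi, Function.update_of_ne hi]
          rfl
      · rw [Function.update_of_ne hj]
        by_cases hi : i' = i
        · subst hi
          rw [Function.update_self, Function.update_of_ne hj]
          rfl
        · rw [Function.update_of_ne hi]
          rfl
    · have h5 := congrArg Prod.snd hij
      exact h5

lemma swap_const : ∀ G : Game, NodeMap.swap (fun _ _ => Hist.swap) G
    (NodeMap.const (fun _ _ => []) G) = NodeMap.const (F := Hist) (fun _ _ => []) G.swap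
  | .terminal _ => rfl
  | .node _ _ c => Prod.ext rfl <| funext fun j => funext fun i => swap_const (c i j)

/-- Exchanging the players in the game and on the tape exchanges them in the run. -/
lemma run_swap (G : Game) (ω : Tape) (T : ℕ) :
    A.run G.swap ω.swap T = NodeMap.swap (fun _ _ => Hist.swap) G (A.run G ω T) := by
  induction T with
  | zero => exact (swap_const G).symm
  | succ T ih => rw [run, ih, iteration_swap, run]

lemma payoff_swap (G : Game) (ω : Tape) (t : ℕ) :
    A.payoff G.swap ω.swap t = unitInterval.symm (A.payoff G ω t) := by
  rw [payoff, run_swap, iteration_swap, payoff]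

lemma empiricalStrategy₂_swap (G : Game) (ω : Tape) (T : ℕ) :
    A.empiricalStrategy₂ G.swap ω.swap T = swapWeights₁ G (A.empiricalStrategy₁ G ω T) := by
  rw [empiricalStrategy₂, run_swap]
  exact NodeMap.map_swap (fun _ _ H => H.empirical₂_swap) G _

lemma averageStrategy₂_swap (G : Game) (ω : Tape) (T : ℕ) :
    A.averageStrategy₂ G.swap ω.swap T = swapWeights₁ G (A.averageStrategy₁ G ω T) := by
  rw [averageStrategy₂, run_swap]
  exact NodeMap.map_swap (fun _ _ H => H.average₂_swap A) G _

end BanditAlgorithm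

lemma measurePreserving_comp_tape {f : List (ℕ × ℕ) × Bool × ℕ → List (ℕ × ℕ) × Bool × ℕ}
    (hf : Function.Injective f) :
    MeasurePreserving (fun (ω : Tape) q => ω (f q)) tapeMeasure tapeMeasure where
  measurable := measurable_pi_lambda _ fun _ => measurable_pi_apply _
  map_eq := Measure.map_infinitePi_infinitePi_of_inj (P := fun _ => (volume : Measure I)) hf

lemma Tape.measurePreserving_swap : MeasurePreserving Tape.swap tapeMeasure tapeMeasure := by
  refine measurePreserving_comp_tape (f := fun q => (q.1.map Prod.swap, !q.2.1, q.2.2)) ?_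
  rintro ⟨p, b, t⟩ ⟨p', b', t'⟩ h
  simp only [Prod.mk.injEq, Bool.not_inj_iff] at h ⊢
  exact ⟨List.map_injective_iff.2 Prod.swap_injective h.1, h.2⟩

lemma Tape.measurePreserving_child (i j : ℕ) :
    MeasurePreserving (fun ω : Tape => ω.child i j) tapeMeasure tapeMeasure := by
  refine measurePreserving_comp_tape (f := fun q => ((i, j) :: q.1, q.2)) ?_
  rintro ⟨p, q⟩ ⟨p', q'⟩ h
  simpa using h

/-! ### Payoffs and best responses -/

lemma Game.depth_child_le {m n : ℕ} (c : Fin (m + 1) → Fin (n + 1) → Game) (i : Fin (m + 1))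
    (j : Fin (n + 1)) : (c i j).depth + 1 ≤ (Game.node m n c).depth := by
  have h : (c i j).depth ≤ Finset.univ.sup fun i => Finset.univ.sup fun j => (c i j).depth :=
    (Finset.le_sup (f := fun j => (c i j).depth) (Finset.mem_univ j)).trans
      (Finset.le_sup (f := fun i => Finset.univ.sup fun j => (c i j).depth) (Finset.mem_univ i))
  rw [Game.depth, add_comm]
  exact Nat.add_le_add_left h 1

lemma Hist.empirical₂_mem {m n : ℕ} {H : Hist m n} (hH : H ≠ []) :
    H.empirical₂ ∈ stdSimplex ℝ (Fin (n + 1)) := by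
  have hpos : (0 : ℝ) < H.length := by exact_mod_cast List.length_pos_iff.2 hH
  refine ⟨fun j => div_nonneg (Nat.cast_nonneg _) (Nat.cast_nonneg _), ?_⟩
  simp only [Hist.empirical₂]
  rw [← Finset.sum_div, div_eq_one_iff_eq hpos.ne', ← Nat.cast_sum]
  have h := Multiset.sum_count_eq_card (s := Finset.univ)
    (m := ((H.map fun e => e.2.1 : List (Fin (n + 1))) : Multiset (Fin (n + 1))))
    fun a _ => Finset.mem_univ a
  simp only [Multiset.coe_count, Multiset.coe_card, List.length_map] at h
  rw [h]

namespace BanditAlgorithm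

lemma average₂_mem (A : BanditAlgorithm) {m n : ℕ} {H : Hist m n} (hH : H ≠ []) :
    H.average₂ A ∈ stdSimplex ℝ (Fin (n + 1)) := by
  have hpos : (0 : ℝ) < H.length := by exact_mod_cast List.length_pos_iff.2 hH
  refine ⟨fun j => div_nonneg (Finset.sum_nonneg fun s _ => (A.prob_mem _ _ _).1)
    (Nat.cast_nonneg _), ?_⟩
  simp only [Hist.average₂]
  rw [← Finset.sum_div, Finset.sum_comm, div_eq_one_iff_eq hpos.ne']
  simp [sum_prob]

/-- Average payoff of player 1 in the first `T` iterations. -/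
def payoffAverage (A : BanditAlgorithm) (G : Game) (ω : Tape) (T : ℕ) : ℝ :=
  (∑ t ∈ Finset.range T, (A.payoff G ω t : ℝ)) / T

lemma payoffAverage_terminal (A : BanditAlgorithm) (u : I) (ω : Tape) {T : ℕ} (hT : T ≠ 0) :
    A.payoffAverage (.terminal u) ω T = u := by
  have h : ∀ t, A.payoff (.terminal u) ω t = u := fun t => rfl
  simp only [payoffAverage, h, Finset.sum_const, Finset.card_range, nsmul_eq_mul]
  exact mul_div_cancel_left₀ _ (Nat.cast_ne_zero.2 hT)

lemma payoffAverage_swap (A : BanditAlgorithm) (G : Game) (ω : Tape) {T : ℕ} (hT : T ≠ 0) :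
    A.payoffAverage G.swap ω.swap T = 1 - A.payoffAverage G ω T := by
  simp only [payoffAverage, payoff_swap, unitInterval.coe_symm_eq, Finset.sum_sub_distrib]
  simp [sub_div, Nat.cast_ne_zero.2 hT]

section Averages

variable (A : BanditAlgorithm) {m n : ℕ} (c : Fin (m + 1) → Fin (n + 1) → Game) (ω : Tape)
  (i : Fin (m + 1)) (j : Fin (n + 1))

lemma plainAverage_eq (N : ℕ) :
    A.plainAverage c ω i j N = A.payoffAverage (c i j) (ω.child i j) N := rfl

lemma plainAverage_mem (N : ℕ) : A.plainAverage c ω i j N ∈ Set.Icc (0 : ℝ) 1 := by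
  refine ⟨div_nonneg (Finset.sum_nonneg fun k _ => (sample_mem c A ω i j k).1)
    (Nat.cast_nonneg N), div_le_one_of_le₀ ?_ (Nat.cast_nonneg N)⟩
  exact (Finset.sum_le_card_nsmul _ _ 1 fun k _ => (sample_mem c A ω i j k).2).trans (by simp)

lemma weightedAverage_mem (N : ℕ) : A.weightedAverage c ω i j N ∈ Set.Icc (0 : ℝ) 1 := by
  refine ⟨div_nonneg (Finset.sum_nonneg fun k _ =>
    mul_nonneg (Nat.cast_nonneg _) (sample_mem c A ω i j k).1)
    (Finset.sum_nonneg fun k _ => Nat.cast_nonneg _), div_le_one_of_le₀ ?_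
    (Finset.sum_nonneg fun k _ => Nat.cast_nonneg _)⟩
  exact Finset.sum_le_sum fun k _ =>
    mul_le_of_le_one_right (Nat.cast_nonneg _) (sample_mem c A ω i j k).2

variable {A} in
lemma UnbiasedPayoffObservations.ae_eventually_lt {ε : ℝ} (h : A.UnbiasedPayoffObservations ε) :
    ∀ᵐ ω ∂tapeMeasure, ∀ η : ℝ, 0 < η → ∀ᶠ N : ℕ in atTop,
      |A.weightedAverage c ω i j N - A.plainAverage c ω i j N| < ε + η := by
  filter_upwards [h m n c i j] with ω hω η hη
  refine eventually_lt_of_limsup_lt (hω.trans_lt (lt_add_of_pos_right ε hη))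
    (isBoundedUnder_of ⟨1, fun N => ?_⟩)
  have h1 := A.plainAverage_mem c ω i j N
  have h2 := A.weightedAverage_mem c ω i j N
  rw [abs_le]
  constructor <;> linarith [h1.1, h1.2, h2.1, h2.2]

variable {A c i j} in
/-- Samples of a terminal child are exact, so that the bias of the observations matters only at
children of positive depth `d`, where it adds to the error `(2 * d - 1) * ε` of the payoffs. -/
lemma eventually_le_weightedAverage {ε v : ℝ} (hv : IsValue (c i j) v)
    (hU : ∀ η : ℝ, 0 < η → ∀ᶠ N : ℕ in atTop,
      |A.weightedAverage c ω i j N - A.plainAverage c ω i j N| < ε + η)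
    (hP : ∀ η : ℝ, 0 < η → ∀ᶠ N : ℕ in atTop,
      v - ((2 * (c i j).depth - 1 : ℕ) : ℝ) * ε - η ≤ A.payoffAverage (c i j) (ω.child i j) N)
    {η : ℝ} (hη : 0 < η) :
    ∀ᶠ N : ℕ in atTop, v - 2 * ((c i j).depth : ℝ) * ε - η ≤ A.weightedAverage c ω i j N := by
  rcases hG : c i j with u | ⟨m', n', c'⟩
  · rw [hG] at hv
    have hv' : v = u := hv
    have hs : ∀ k, A.sample c ω i j k = u := fun k => by rw [sample, hG]; rfl
    filter_upwards [eventually_ne_atTop 0] with N hN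
    have hpos : (0 : ℝ) < ∑ k ∈ Finset.range N, (A.weight c ω i j k : ℝ) :=
      Finset.sum_pos (fun k _ => by exact_mod_cast weight_pos k) (by simpa using hN)
    simp only [weightedAverage, hs, Game.depth]
    rw [← Finset.sum_mul, mul_div_cancel_left₀ _ hpos.ne', hv']
    simp [hη.le]
  · have hd : 1 ≤ (c i j).depth := by rw [hG, Game.depth]; omega
    rw [← hG]
    filter_upwards [hU (η / 2) (half_pos hη), hP (η / 2) (half_pos hη)] with N h1 h2
    rw [Nat.cast_sub (by omega)] at h2
    push_cast at h2
    rw [← plainAverage_eq] at h2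
    have h3 := (abs_lt.1 h1).1
    linarith

end Averages

variable {A : BanditAlgorithm} {ε : ℝ}

lemma run_root_ne_nil {m n : ℕ} (c : Fin (m + 1) → Fin (n + 1) → Game) (ω : Tape) {T : ℕ}
    (hT : T ≠ 0) : (A.run (.node m n c) ω T).1 ≠ [] := by
  rw [← List.length_pos_iff, length_run_root]
  exact Nat.pos_of_ne_zero hT

/-- Against the empirical frequencies of player 2 at the root, no action of player 1 is, in the
matrix `w` of the values of the children, better than the average payoff by more than the sum of the
regret `ε` and the error of the observed values of the children. -/
lemma eventually_empirical_le (hA : A.IsHannanConsistent ε) (hGE : A.GuaranteedExploration)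
    (hUPO : A.UnbiasedPayoffObservations ε) (hε : 0 ≤ ε) {m n d : ℕ}
    {c : Fin (m + 1) → Fin (n + 1) → Game} (hd : ∀ i j, (c i j).depth ≤ d)
    {w : Fin (m + 1) → Fin (n + 1) → ℝ} (hw : ∀ i j, IsValue (c i j) (w i j))
    (hP : ∀ i j, ∀ᵐ ω ∂tapeMeasure, ∀ η : ℝ, 0 < η → ∀ᶠ N : ℕ in atTop,
      w i j - ((2 * (c i j).depth - 1 : ℕ) : ℝ) * ε - η ≤ A.payoffAverage (c i j) ω N) :
    ∀ᵐ ω ∂tapeMeasure, ∀ η : ℝ, 0 < η → ∀ᶠ T : ℕ in atTop, ∀ i,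
      ∑ j, (A.run (.node m n c) ω T).1.empirical₂ j * w i j ≤
        A.payoffAverage (.node m n c) ω T + (2 * d + 1) * ε + η := by
  have hP' : ∀ i j, ∀ᵐ ω ∂tapeMeasure, ∀ η : ℝ, 0 < η → ∀ᶠ N : ℕ in atTop,
      w i j - ((2 * (c i j).depth - 1 : ℕ) : ℝ) * ε - η ≤
        A.payoffAverage (c i j) (ω.child i j) N := fun i j =>
    (Tape.measurePreserving_child i j).quasiMeasurePreserving.ae (hP i j)
  filter_upwards [hA.ae_eventually_le c, ae_all_iff.2 fun i => ae_all_iff.2 fun j => hGE m n c i j,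
    ae_all_iff.2 fun i => ae_all_iff.2 fun j => hUPO.ae_eventually_lt c i j,
    ae_all_iff.2 fun i => ae_all_iff.2 fun j => hP' i j] with ω h1 h2 h3 h4 η hη
  have h5 : ∀ i, ∀ᶠ T : ℕ in atTop,
      ∑ j, (A.run (.node m n c) ω T).1.empirical₂ j * (w i j - 2 * d * ε - η / 2) ≤
      (∑ t ∈ Finset.range T, A.hypothetical c ω i t) / T := by
    refine fun i => eventually_sum_le_hypothetical (h2 i) fun j => ?_
    filter_upwards [eventually_le_weightedAverage ω (hw i j) (h3 i j) (h4 i j) (half_pos hη)]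
      with N hN
    have : ((c i j).depth : ℝ) * ε ≤ d * ε :=
      mul_le_mul_of_nonneg_right (by exact_mod_cast hd i j) hε
    linarith
  filter_upwards [eventually_all.2 h5, h1 (η / 2) (half_pos hη), eventually_ne_atTop 0]
    with T h6 h7 hT i
  have h8 := (h6 i).trans (h7 i)
  have hs := (Hist.empirical₂_mem (run_root_ne_nil (A := A) c ω hT)).2
  simp only [mul_sub, Finset.sum_sub_distrib, ← Finset.sum_mul, hs] at h8
  rw [payoffAverage]
  linarith

/-- Asymptotically, player 1 is paid the value of the game up to an error `(2 * d - 1) * ε`, where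
`d` is the depth: every level adds `ε` for the regret and, unless the children are terminal, `ε` for
the bias of the observations. The truncated subtraction makes the error `0` for terminal games. -/
theorem eventually_le_payoffAverage (hA : A.IsHannanConsistent ε) (hGE : A.GuaranteedExploration)
    (hUPO : A.UnbiasedPayoffObservations ε) (hε : 0 ≤ ε) : ∀ {G : Game} {v : ℝ}, IsValue G v →
    ∀ᵐ ω ∂tapeMeasure, ∀ η : ℝ, 0 < η → ∀ᶠ T : ℕ in atTop,
      v - ((2 * G.depth - 1 : ℕ) : ℝ) * ε - η ≤ A.payoffAverage G ω T
  | .terminal u, v, hv => .of_forall fun ω η hη => by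
    have hv' : v = u := hv
    filter_upwards [eventually_ne_atTop 0] with T hT
    rw [payoffAverage_terminal A u ω hT, hv']
    simp [Game.depth, hη.le]
  | .node m n c, v, ⟨w, hw, ha, _⟩ => by
    obtain ⟨d, hd⟩ : ∃ d, (Game.node m n c).depth = d + 1 := ⟨_, by rw [Game.depth, add_comm]⟩
    filter_upwards [eventually_empirical_le hA hGE hUPO hε
      (fun i j => by have := Game.depth_child_le c i j; omega : ∀ i j, (c i j).depth ≤ d) hw
      fun i j => eventually_le_payoffAverage hA hGE hUPO hε (hw i j)] with ω hω η hη
    filter_upwards [hω η hη, eventually_ne_atTop 0] with T h1 hT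
    obtain ⟨i, hi⟩ := ha _ (Hist.empirical₂_mem (run_root_ne_nil (A := A) c ω hT))
    have h2 := h1 i
    rw [hd, show 2 * (d + 1) - 1 = 2 * d + 1 by omega]
    push_cast
    linarith

theorem eventually_payoffAverage_le (hA : A.IsHannanConsistent ε) (hGE : A.GuaranteedExploration)
    (hUPO : A.UnbiasedPayoffObservations ε) (hε : 0 ≤ ε) {G : Game} {v : ℝ} (hv : IsValue G v) :
    ∀ᵐ ω ∂tapeMeasure, ∀ η : ℝ, 0 < η → ∀ᶠ T : ℕ in atTop,
      A.payoffAverage G ω T ≤ v + ((2 * G.depth - 1 : ℕ) : ℝ) * ε + η := by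
  filter_upwards [Tape.measurePreserving_swap.quasiMeasurePreserving.ae
    (eventually_le_payoffAverage hA hGE hUPO hε hv.swap)] with ω hω η hη
  filter_upwards [hω η hη, eventually_ne_atTop 0] with T h1 hT
  rw [payoffAverage_swap A G ω hT, Game.depth_swap] at h1
  linarith

/-- `ρ` turns the contents of a node into a mixed action of player 2 that has the same limiting
behavior as the empirical frequencies. -/
structure IsEstimate (A : BanditAlgorithm) (ρ : ∀ m n, Hist m n → Fin (n + 1) → ℝ) : Prop where
  mem : ∀ {m n : ℕ} {H : Hist m n}, H ≠ [] → ρ m n H ∈ stdSimplex ℝ (Fin (n + 1))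
  tendsto : ∀ {m n : ℕ} (c : Fin (m + 1) → Fin (n + 1) → Game) (j : Fin (n + 1)),
    ∀ᵐ ω ∂tapeMeasure, Tendsto (fun T => (A.run (.node m n c) ω T).1.empirical₂ j -
      ρ m n (A.run (.node m n c) ω T).1 j) atTop (nhds 0)

lemma isEstimate_empirical (A : BanditAlgorithm) :
    IsEstimate A fun _ _ H => H.empirical₂ where
  mem := Hist.empirical₂_mem
  tendsto _ _ := .of_forall fun _ => by simp only [sub_self]; exact tendsto_const_nhds

lemma isEstimate_average (A : BanditAlgorithm) :
    IsEstimate A fun _ _ H => H.average₂ A where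
  mem := A.average₂_mem
  tendsto c j := A.ae_tendsto_empirical_sub_average c j

/-- Asymptotically, the estimates form a strategy of player 2 against which player 1 cannot get more
than the value of the game plus `2 * d ^ 2 * ε`, where `d` is the depth: a node of depth `d` adds
twice the error `(2 * d - 1) * ε` of its payoffs. -/
theorem eventually_utility_le (hA : A.IsHannanConsistent ε) (hGE : A.GuaranteedExploration)
    (hUPO : A.UnbiasedPayoffObservations ε) (hε : 0 ≤ ε)
    {ρ : ∀ m n, Hist m n → Fin (n + 1) → ℝ} (hρ : IsEstimate A ρ) :
    ∀ {G : Game} {v : ℝ}, IsValue G v →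
    ∀ᵐ ω ∂tapeMeasure, ∀ η : ℝ, 0 < η → ∀ᶠ T : ℕ in atTop,
      IsStrategy₂ G (NodeMap.map ρ G (A.run G ω T)) ∧ ∀ s₁, IsStrategy₁ G s₁ →
        utility G s₁ (NodeMap.map ρ G (A.run G ω T)) ≤ v + 2 * (G.depth : ℝ) ^ 2 * ε + η
  | .terminal u, v, hv => .of_forall fun ω η hη => .of_forall fun T => by
    have hv' : v = u := hv
    refine ⟨trivial, fun s₁ _ => ?_⟩
    rw [hv', utility, Game.depth]
    simp [hη.le]
  | .node m n c, v, ⟨w, hw, ha, hb⟩ => by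
    obtain ⟨d, hd⟩ : ∃ d, (Game.node m n c).depth = d + 1 := ⟨_, by rw [Game.depth, add_comm]⟩
    have hd' : ∀ i j, (c i j).depth ≤ d := fun i j => by
      have := Game.depth_child_le c i j; omega
    have ih := fun (i : Fin (m + 1)) (j : Fin (n + 1)) =>
      (Tape.measurePreserving_child i j).quasiMeasurePreserving.ae
      (eventually_utility_le hA hGE hUPO hε hρ (hw i j))
    have hup := eventually_payoffAverage_le hA hGE hUPO hε
      (show IsValue (.node m n c) v from ⟨w, hw, ha, hb⟩)
    have hemp := eventually_empirical_le hA hGE hUPO hε hd' hw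
      fun i j => eventually_le_payoffAverage hA hGE hUPO hε (hw i j)
    filter_upwards [hup, hemp, ae_all_iff.2 fun i => ae_all_iff.2 fun j => hGE m n c i j,
      ae_all_iff.2 fun j => hρ.tendsto c j, ae_all_iff.2 fun i => ae_all_iff.2 fun j => ih i j]
      with ω h1 h2 h3 h4 h5 η hη
    have h6 : ∀ i, ∀ᶠ T : ℕ in atTop,
        ∑ j, ((A.run (.node m n c) ω T).1.empirical₂ j -
          ρ m n (A.run (.node m n c) ω T).1 j) * w i j > -(η / 4) := by
      intro i
      have : Tendsto (fun T => ∑ j, ((A.run (.node m n c) ω T).1.empirical₂ j -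
          ρ m n (A.run (.node m n c) ω T).1 j) * w i j) atTop (nhds 0) := by
        simpa using tendsto_finsetSum Finset.univ fun j _ => (h4 j).mul_const (w i j)
      exact this.eventually_const_lt (by linarith)
    have h7 := fun i j => (h3 i j).eventually (h5 i j (η / 4) (by positivity))
    filter_upwards [h1 (η / 4) (by positivity), h2 (η / 4) (by positivity), eventually_all.2 h6,
      eventually_all.2 fun i => eventually_all.2 fun j => h7 i j, eventually_ne_atTop 0]
      with T h1 h2 h6 h7 hT
    simp only [← run_child] at h7
    have hmem := hρ.mem (run_root_ne_nil (A := A) c ω hT)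
    refine ⟨⟨hmem, fun i j => (h7 i j).1⟩, fun s₁ hs₁ => ?_⟩
    rw [hd] at h1 ⊢
    rw [show 2 * (d + 1) - 1 = 2 * d + 1 by omega] at h1
    push_cast at h1 ⊢
    have hrow : ∀ i, ∑ j, ρ m n (A.run (.node m n c) ω T).1 j * w i j ≤
        v + 2 * (2 * d + 1) * ε + 3 * (η / 4) := by
      intro i
      have := h6 i
      simp only [sub_mul, Finset.sum_sub_distrib] at this
      linarith [h2 i]
    have hchild : ∀ i j, utility (c i j) (s₁.2 i j)
        (NodeMap.map ρ (c i j) ((A.run (.node m n c) ω T).2 i j)) ≤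
          w i j + (2 * (d : ℝ) ^ 2 * ε + η / 4) := by
      intro i j
      have h8 : ((c i j).depth : ℝ) ^ 2 * ε ≤ (d : ℝ) ^ 2 * ε :=
        mul_le_mul_of_nonneg_right
          (pow_le_pow_left₀ (Nat.cast_nonneg _) (by exact_mod_cast hd' i j) 2) hε
      linarith [(h7 i j).2 _ (hs₁.2 i j)]
    calc utility (.node m n c) s₁ (NodeMap.map ρ (.node m n c) (A.run (.node m n c) ω T))
        = ∑ i, s₁.1 i * ∑ j, ρ m n (A.run (.node m n c) ω T).1 j * utility (c i j) (s₁.2 i j)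
            (NodeMap.map ρ (c i j) ((A.run (.node m n c) ω T).2 i j)) := by
          simp only [Finset.mul_sum, ← mul_assoc]
          rfl
      _ ≤ ∑ i, s₁.1 i * (v + 2 * ((d : ℝ) + 1) ^ 2 * ε + η) := by
          refine Finset.sum_le_sum fun i _ => mul_le_mul_of_nonneg_left ?_ (hs₁.1.1 i)
          refine (Finset.sum_le_sum fun j _ =>
            mul_le_mul_of_nonneg_left (hchild i j) (hmem.1 j)).trans ?_
          simp only [mul_add, Finset.sum_add_distrib, ← Finset.sum_mul, hmem.2]
          linarith [hrow i]
      _ = v + 2 * ((d : ℝ) + 1) ^ 2 * ε + η := by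
          rw [← Finset.sum_mul, hs₁.1.2, one_mul]

end BanditAlgorithm

lemma four_mul_sq_le (D : ℕ) :
    4 * (D : ℝ) ^ 2 ≤ 12 * ((2 : ℝ) ^ D - 1) - 8 * (D : ℝ) := by
  induction D with
  | zero => simp
  | succ D ih =>
    rw [pow_succ (2 : ℝ)]
    push_cast
    nlinarith [sq_nonneg (D : ℝ)]

namespace BanditAlgorithm

variable {A : BanditAlgorithm} {ε : ℝ}

/-- If both players use estimates of their empirical frequencies, then each of them guarantees the
value of the game up to `2 * d ^ 2 * ε`, so that the profile is an approximate equilibrium. The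
estimate `s₁` for player 1 is described as the one that turns into the estimate for player 2 when
the players are exchanged. -/
theorem ae_eventually_isApproxNash (hA : A.IsHannanConsistent ε) (hGE : A.GuaranteedExploration)
    (hUPO : A.UnbiasedPayoffObservations ε) (hε : 0 ≤ ε) (G : Game)
    {ρ : ∀ m n, Hist m n → Fin (n + 1) → ℝ} (hρ : IsEstimate A ρ) :
    ∀ᵐ ω ∂tapeMeasure, ∀ η : ℝ, 0 < η → ∀ᶠ T : ℕ in atTop,
      ∀ s₁ : Weights₁ G,
        NodeMap.map ρ G.swap (A.run G.swap ω.swap T) = swapWeights₁ G s₁ →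
          IsApproxNash G ((12 * ((2 : ℝ) ^ G.depth - 1) - 8 * (G.depth : ℝ)) * ε + η) s₁
            (NodeMap.map ρ G (A.run G ω T)) := by
  obtain ⟨v, hv⟩ := exists_isValue G
  filter_upwards [eventually_utility_le hA hGE hUPO hε hρ hv,
    Tape.measurePreserving_swap.quasiMeasurePreserving.ae
      (eventually_utility_le hA hGE hUPO hε hρ hv.swap)] with ω h1 h2 η hη
  filter_upwards [h1 (η / 2) (half_pos hη), h2 (η / 2) (half_pos hη)]
    with T ⟨h3, h4⟩ ⟨hs₁, h5⟩ s₁ hs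
  rw [hs, isStrategy₂_swapWeights₁] at hs₁
  rw [hs, Game.depth_swap] at h5
  have h6 : ∀ s₂, IsStrategy₂ G s₂ → v - 2 * (G.depth : ℝ) ^ 2 * ε - η / 2 ≤ utility G s₁ s₂ := by
    intro s₂ hs₂
    have := h5 _ (isStrategy₁_swapWeights₂.2 hs₂)
    rw [utility_swap G s₁ s₂ hs₁ hs₂] at this
    linarith
  have hC := mul_le_mul_of_nonneg_right (four_mul_sq_le G.depth) hε
  exact ⟨hs₁, h3, fun s₁' hs₁' => by linarith [h4 s₁' hs₁', h6 _ h3],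
    fun s₂' hs₂' => by linarith [h4 s₁ hs₁, h6 s₂' hs₂']⟩

end BanditAlgorithm

end

theorem mainTheorem2 (A : BanditAlgorithm) (ε : ℝ) (hε : 0 ≤ ε)
    (hHC : A.IsHannanConsistent ε) (hGE : A.GuaranteedExploration)
    (hUPO : A.UnbiasedPayoffObservations ε) (G : Game) :
    ∀ᵐ ω ∂tapeMeasure, ∀ η : ℝ, 0 < η → ∀ᶠ T : ℕ in atTop,
      IsApproxNash G ((12 * ((2 : ℝ) ^ G.depth - 1) - 8 * (G.depth : ℝ)) * ε + η)
          (A.averageStrategy₁ G ω T) (A.averageStrategy₂ G ω T) ∧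
        IsApproxNash G ((12 * ((2 : ℝ) ^ G.depth - 1) - 8 * (G.depth : ℝ)) * ε + η)
          (A.empiricalStrategy₁ G ω T) (A.empiricalStrategy₂ G ω T) := by
  filter_upwards [
    BanditAlgorithm.ae_eventually_isApproxNash hHC hGE hUPO hε G A.isEstimate_average,
    BanditAlgorithm.ae_eventually_isApproxNash hHC hGE hUPO hε G A.isEstimate_empirical]
    with ω h₁ h₂ η hη
  filter_upwards [h₁ η hη, h₂ η hη] with T h₃ h₄
  exact ⟨h₃ _ (A.averageStrategy₂_swap G ω T), h₄ _ (A.empiricalStrategy₂_swap G ω T)⟩
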